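/- Let $\phi$ be the standard Gaussian density. For a probability distribution $P$ on $\mathbb R$ let $f_P(x)=\int\phi(x-\theta)\,dP(\theta)$ be the density of the Gaussian location mixture with mixing distribution $P$, and let $H(f,g)=\big(\int(\sqrt f-\sqrt g)^2\,dx\big)^{1/2}$ be the Hellinger distance. For $M>0$ let $\mathcal P_{\rm bdd}(M)$ be the set of probability distributions $P$ with $P[-M,M]=1$. For $\alpha,\beta>0$ let $\mathcal P_\alpha(\beta)$ be the set of laws $P$ of real random variables $X$ with $\inf\{t>0:\mathbb E[\exp((|X|/t)^\alpha)-1]\le 1\}\le\beta$ (where $\inf\emptyset=\infty$). Let $n\ge 2$ and let $X_1,\dots,X_n$ be independent observations with common density $f_{P^\star}$. For a class $\mathcal Q$ of probability distributions on $\mathbb R$, the nonparametric maximum likelihood estimator (NPMLE) constrained to $\mathcal Q$ is any solution $$\hat P\in\operatorname*{argmax}_{Q\in\mathcal Q}\ \frac1n\sum_{i=1}^n\log f_Q(X_i).$$ 1. For every constant $c>0$ there exist constants $s^\star,c'>0$, depending only on $c$, such that the following holds for all $n\ge2$ and all $0<M\le n^c$. If $P^\star\in\mathcal P_{\rm bdd}(M)$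 and $\hat P$ is an NPMLE constrained to $\mathcal Q=\mathcal P_{\rm bdd}(M)$, then for every $s\ge s^\star$, $$\mathbb P\big[H(f_{\hat P},f_{P^\star})\ge s\,\epsilon_n\big]\le n^{-c's^2},\qquad \epsilon_n=\frac{\log n}{\sqrt{n\log\big(1+\sqrt{\log n}/M\big)}}.$$ 2. For all constants $\alpha>0$ and $c>0$ there exist constants $s^\star,c'>0$, depending only on $\alpha$ and $c$, such that the following holds for all $n\ge2$ and all $0<\beta\le n^c$. If $P^\star\in\mathcal P_\alpha(\beta)$ and $\hat P$ is an NPMLE constrained to $\mathcal Q=\mathcal P_\alpha(\beta)$, then for every $s\ge s^\star$, $$\mathbb P\big[H(f_{\hat P},f_{P^\star})\ge s\,\epsilon_n\big]\le n^{-c's^2},\qquad \epsilon_n=\frac{\log n}{\sqrt{n\log\big(1+(\log n)^{\frac{\alpha-2}{2\alpha}}/\beta\big)}}.$$ -/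

import Mathlib

open MeasureTheory ProbabilityTheory
open scoped ENNReal

noncomputable section

namespace GaussianMixture

/-- The density `f_P` of the Gaussian location mixture `P * N(0,1)`:
`f_P(x) = ∫ φ(x - θ) dP(θ)`, with `φ` the standard Gaussian density. -/
def mixDensity (P : ProbabilityMeasure ℝ) (x : ℝ) : ℝ :=
  ∫ θ, gaussianPDFReal 0 1 (x - θ) ∂(P : Measure ℝ)

/-- The probability law on the real line with Lebesgue density `f_P`. -/
def mixLaw (P : ProbabilityMeasure ℝ) : Measure ℝ :=
  volume.withDensity fun x => ENNReal.ofReal (mixDensity P x)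

/-- The Hellinger distance of two densities: `H(f,g)² = ∫ (√f - √g)²` (no factor `1/2`). -/
def hellinger (f g : ℝ → ℝ) : ℝ :=
  √(∫ x, (√(f x) - √(g x)) ^ 2)

/-- Distributions supported on `[-M, M]`. -/
def boundedFamily (M : ℝ) : Set (ProbabilityMeasure ℝ) :=
  {P | (P : Measure ℝ) (Set.Icc (-M) M) = 1}

/-- The `ψ`-Orlicz norm of `X ∼ P`: `inf {t > 0 : E ψ(|X| / t) ≤ 1}`,
with value `∞` if there is no such `t`. -/
def orliczNorm (ψ : ℝ → ℝ) (P : ProbabilityMeasure ℝ) : ℝ≥0∞ :=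
  sInf {r | ∃ t : ℝ, 0 < t ∧ ∫⁻ x, ENNReal.ofReal (ψ (|x| / t)) ∂(P : Measure ℝ) ≤ 1 ∧
    r = ENNReal.ofReal t}

/-- The sub-Weibull family: distributions whose Orlicz norm
for `ψ(x) = exp(x ^ α) - 1` is at most `β`. -/
def subWeibullFamily (α β : ℝ) : Set (ProbabilityMeasure ℝ) :=
  {P | orliczNorm (fun x => Real.exp (x ^ α) - 1) P ≤ ENNReal.ofReal β}

/-- The normalized log-likelihood of the mixing distribution `Q` given the sample `x`. -/
def logLikelihood {n : ℕ} (x : Fin n → ℝ) (Q : ProbabilityMeasure ℝ) : ℝ :=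
  (1 / (n : ℝ)) * ∑ i, Real.log (mixDensity Q (x i))

/-- `Phat` is a nonparametric maximum likelihood estimate over the class `𝒬`
given the sample `x`. -/
def IsNPMLE {n : ℕ} (𝒬 : Set (ProbabilityMeasure ℝ)) (x : Fin n → ℝ)
    (Phat : ProbabilityMeasure ℝ) : Prop :=
  Phat ∈ 𝒬 ∧ IsMaxOn (logLikelihood x) 𝒬 Phat

/-- The rate for the family of distributions supported on `[-M, M]`. -/
def rateBounded (n : ℕ) (M : ℝ) : ℝ :=
  Real.log n / √(n * Real.log (1 + √(Real.log n) / M))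

/-- The rate for the sub-Weibull family. -/
def rateSubWeibull (n : ℕ) (α β : ℝ) : ℝ :=
  Real.log n / √(n * Real.log (1 + (Real.log n) ^ ((α - 2) / (2 * α)) / β))

end GaussianMixture

end

/-!
The proof is a sieve argument with an explicit quantization of the class.

*Reduction to finitely many densities.* Suppose a class `𝒬` containing the truth `P` is split into
finitely many cells such that any two mixture densities from one cell differ by at most `η`
uniformly. If the NPMLE lies in the cell of `Q`, then the likelihood of the inflated density
`f_Q + η` is at least that of `f_P`. By Markov's inequality for the square root of the likelihood
ratio this has probability at most `(∫ √((f_Q + η) f_P)) ^ n`, and the integral is at most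
`1 - H(f_Q, f_P)² / 2 + O(√η)` since `√f_P` is integrable as soon as `P` has a fourth moment
(`measure_prod_le_prod_le`). Choosing `Q` in the cell at Hellinger distance at least `τ` from the
truth and summing over the cells gives the bound
`#cells * exp (-n (τ² / 2 - O(√η)))` (`measureReal_hellinger_npmle_le`). No measurability of the
estimator is needed.

*Counting the cells.* From `φ(y - t) = φ(y) exp (y t) exp (-t² / 2)` and
`|y| ^ l * φ(y) ≤ √l!`, the part of `f_Q` due to the mass of `Q` in an interval of half-length `r`
is determined, up to an error `∑_{l ≥ L} r ^ l / √l!`, by `L` weighted local moments. Rounding these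
moments gives the cells (`exists_quantization`). With `r = min M √(log n)`, the number of intervals
times the number of moments is of order `log n / log (1 + √(log n) / M)` at accuracy `n ^ (-6)`, and
each moment is rounded to one of polynomially many values. The logarithm of the number of cells is
therefore of the order of `n` times the squared rate (`exists_code`).

*Extreme radii.* For `M ≥ n` a multiple of the rate exceeds `√2`, the largest Hellinger distance. For `M ≤ n ^ (-4)` all
mixtures of the class are within Hellinger distance `O(M ^ (1/4))` of each other, which is
below a multiple of the rate. Hence no upper bound on `M` is needed, and constants do not depend on it.

*Sub-Weibull class.* It is enough that the mass outside `[-M, M]` is at most `2 n ^ (-6)` and that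
fourth moments are of order `M ^ 4`. Both hold for `M = 2 β (6 log n) ^ (1/α)`
(`subWeibullRadius`), and the two rates agree up to a constant
(`rateBounded_subWeibullRadius_le`).
-/

open MeasureTheory ProbabilityTheory
open scoped ENNReal

namespace GaussianMixture

/-! ### The Gaussian kernel -/

theorem gaussianPDFReal_zero_one_eq (y : ℝ) :
    gaussianPDFReal 0 1 y = (√(2 * Real.pi))⁻¹ * Real.exp (-y ^ 2 / 2) := by
  simp [gaussianPDFReal]

theorem gaussianPDFReal_zero_one_le (y : ℝ) :
    gaussianPDFReal 0 1 y ≤ Real.exp (-y ^ 2 / 2) := by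
  rw [gaussianPDFReal_zero_one_eq]
  have h : (√(2 * Real.pi))⁻¹ ≤ 1 := by
    apply inv_le_one_of_one_le₀
    rw [Real.one_le_sqrt]
    linarith [Real.pi_gt_three]
  exact mul_le_of_le_one_left (Real.exp_nonneg _) h

theorem gaussianPDFReal_zero_one_le_one (y : ℝ) : gaussianPDFReal 0 1 y ≤ 1 :=
  (gaussianPDFReal_zero_one_le y).trans (Real.exp_le_one_iff.2 (by nlinarith [sq_nonneg y]))

theorem gaussianPDFReal_zero_one_sub (y t : ℝ) :
    gaussianPDFReal 0 1 (y - t) =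
      gaussianPDFReal 0 1 y * Real.exp (y * t) * Real.exp (-t ^ 2 / 2) := by
  rw [gaussianPDFReal_zero_one_eq, gaussianPDFReal_zero_one_eq, mul_assoc, mul_assoc,
    ← Real.exp_add, ← Real.exp_add]
  ring_nf

/-- The coefficients `φ(y) yˡ / l!` of the expansion of `t ↦ φ(y) exp (y t)` are at most
`1 / √l!`, uniformly in `y`. -/
theorem abs_pow_mul_gaussianPDFReal_le (y : ℝ) (l : ℕ) :
    |y| ^ l * gaussianPDFReal 0 1 y ≤ √(l.factorial : ℝ) := by
  refine (mul_le_mul_of_nonneg_left (gaussianPDFReal_zero_one_le y) (by positivity)).trans ?_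
  apply Real.le_sqrt_of_sq_le
  have h := Real.pow_div_factorial_le_exp (x := y ^ 2) (sq_nonneg y) l
  rw [div_le_iff₀ (by positivity)] at h
  have e : (|y| ^ l * Real.exp (-y ^ 2 / 2)) ^ 2 = (y ^ 2) ^ l * Real.exp (-y ^ 2) := by
    rw [mul_pow, ← pow_mul, mul_comm l 2, pow_mul, sq_abs, ← Real.exp_nat_mul]
    congr 2
    push_cast; ring
  rw [e]
  calc _ ≤ Real.exp (y ^ 2) * l.factorial * Real.exp (-y ^ 2) := by gcongr
    _ = _ := by
      rw [mul_right_comm, ← Real.exp_add]; simp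

theorem gaussianPDFReal_mul_sum_le (y : ℝ) {r : ℝ} (hr : 0 ≤ r) (L : ℕ) :
    ∑ l ∈ Finset.range L, |gaussianPDFReal 0 1 y * y ^ l / l.factorial * r ^ l| ≤
      Real.exp (r ^ 2 / 2) := by
  have h := Real.sum_le_exp_of_nonneg (x := |y| * r) (by positivity) L
  calc _ = gaussianPDFReal 0 1 y * ∑ l ∈ Finset.range L, (|y| * r) ^ l / l.factorial := by
        rw [Finset.mul_sum]
        refine Finset.sum_congr rfl fun l _ => ?_
        rw [abs_mul, abs_div, abs_mul, abs_pow, abs_pow, abs_of_nonneg hr,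
          abs_of_nonneg (gaussianPDFReal_nonneg 0 1 y), Nat.abs_cast, mul_pow]
        ring
    _ ≤ Real.exp (-y ^ 2 / 2) * Real.exp (|y| * r) := by
        gcongr
        exact gaussianPDFReal_zero_one_le y
    _ ≤ _ := by
        rw [← Real.exp_add, Real.exp_le_exp, ← sq_abs y]
        nlinarith [sq_nonneg (|y| - r)]

/-- Truncation error of the expansion `φ(y - t) = ∑ φ(y) yˡ / l! · tˡ exp (-t² / 2)`. -/
theorem abs_gaussianPDFReal_sub_sum_le {y t r q : ℝ} (L : ℕ) (ht : |t| ≤ r)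
    (hq0 : 0 ≤ q) (hq1 : q < 1)
    (hq : ∀ l, L ≤ l → r ^ l / √(l.factorial : ℝ) ≤ q ^ l) :
    |gaussianPDFReal 0 1 (y - t) - ∑ l ∈ Finset.range L,
      gaussianPDFReal 0 1 y * y ^ l / l.factorial * (t ^ l * Real.exp (-t ^ 2 / 2))| ≤
      q ^ L * (1 - q)⁻¹ := by
  have hr : 0 ≤ r := (abs_nonneg t).trans ht
  set g : ℕ → ℝ := fun l =>
    gaussianPDFReal 0 1 y * y ^ l / l.factorial * (t ^ l * Real.exp (-t ^ 2 / 2)) with hg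
  have hsum : HasSum g (gaussianPDFReal 0 1 (y - t)) := by
    have h := ((NormedSpace.expSeries_div_hasSum_exp (y * t)).mul_left
      (gaussianPDFReal 0 1 y)).mul_right (Real.exp (-t ^ 2 / 2))
    rw [← Real.exp_eq_exp_ℝ, ← gaussianPDFReal_zero_one_sub] at h
    convert! h using 2 with l
    simp only [hg, mul_pow]; ring
  have htail : HasSum (fun l => g (l + L))
      (gaussianPDFReal 0 1 (y - t) - ∑ l ∈ Finset.range L, g l) :=
    (hasSum_nat_add_iff' L).2 hsum
  have hgeo : HasSum (fun l => q ^ L * q ^ l) (q ^ L * (1 - q)⁻¹) :=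
    (hasSum_geometric_of_lt_one hq0 hq1).mul_left _
  rw [← htail.tsum_eq, ← Real.norm_eq_abs]
  refine tsum_of_norm_bounded hgeo fun l => ?_
  rw [← pow_add, add_comm L l]
  refine le_trans ?_ (hq (l + L) (by omega))
  generalize l + L = m
  have h1 := abs_pow_mul_gaussianPDFReal_le y m
  have h2 : Real.exp (-t ^ 2 / 2) ≤ 1 := Real.exp_le_one_iff.2 (by nlinarith [sq_nonneg t])
  have hs : 0 < √(m.factorial : ℝ) := Real.sqrt_pos.2 (by positivity)
  have h3 : (m.factorial : ℝ) = √(m.factorial : ℝ) * √(m.factorial : ℝ) :=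
    (Real.mul_self_sqrt (by positivity)).symm
  calc ‖g m‖ = (|y| ^ m * gaussianPDFReal 0 1 y) / m.factorial *
        (|t| ^ m * Real.exp (-t ^ 2 / 2)) := by
        simp only [hg, Real.norm_eq_abs]
        rw [abs_mul, abs_div, abs_mul, abs_pow, abs_mul, abs_pow, Nat.abs_cast, Real.abs_exp,
          abs_of_nonneg (gaussianPDFReal_nonneg 0 1 y), mul_comm (gaussianPDFReal 0 1 y)]
    _ ≤ √(m.factorial : ℝ) / m.factorial * (r ^ m * 1) := by gcongr
    _ = r ^ m / √(m.factorial : ℝ) := by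
        nth_rw 2 [h3]
        field_simp

theorem abs_gaussianPDFReal_sub_le (y t : ℝ) :
    |gaussianPDFReal 0 1 (y - t) - gaussianPDFReal 0 1 y| ≤ |t| := by
  have hd : ∀ x : ℝ, HasDerivAt (gaussianPDFReal 0 1) (-x * gaussianPDFReal 0 1 x) x := by
    intro x
    have h : HasDerivAt (fun y : ℝ => (√(2 * Real.pi))⁻¹ * Real.exp (-y ^ 2 / 2))
        ((√(2 * Real.pi))⁻¹ * (Real.exp (-x ^ 2 / 2) * (-(2 * x) / 2))) x := by
      refine (HasDerivAt.exp ?_).const_mul _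
      simpa using ((hasDerivAt_pow 2 x).neg).div_const 2
    have e : gaussianPDFReal 0 1 = fun y : ℝ => (√(2 * Real.pi))⁻¹ * Real.exp (-y ^ 2 / 2) :=
      funext gaussianPDFReal_zero_one_eq
    rw [e]
    convert! h using 1
    ring
  have hb : ∀ x : ℝ, ‖-x * gaussianPDFReal 0 1 x‖ ≤ 1 := by
    intro x
    have h := abs_pow_mul_gaussianPDFReal_le x 1
    rw [norm_mul, norm_neg, Real.norm_eq_abs, Real.norm_eq_abs,
      abs_of_nonneg (gaussianPDFReal_nonneg 0 1 x)]
    simpa using h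
  have h := Convex.norm_image_sub_le_of_norm_hasDerivWithin_le (s := Set.univ)
    (fun x _ => (hd x).hasDerivWithinAt) (fun x _ => hb x) convex_univ
    (Set.mem_univ y) (Set.mem_univ (y - t))
  simpa using h

theorem gaussianPDFReal_decay (x θ : ℝ) :
    gaussianPDFReal 0 1 (x - θ) ≤ 200 * (1 + θ ^ 4) / (1 + x ^ 2) ^ 2 := by
  rw [le_div_iff₀ (by positivity)]
  obtain ⟨y, rfl⟩ : ∃ y, x = y + θ := ⟨x - θ, by ring⟩
  rw [add_sub_cancel_right]
  have hz := Real.pow_div_factorial_le_exp (x := y ^ 2 / 2) (by positivity) 2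
  have h0 := gaussianPDFReal_nonneg 0 1 y
  have h1 := gaussianPDFReal_zero_one_le_one y
  have h4 : y ^ 4 * gaussianPDFReal 0 1 y ≤ 8 := by
    calc _ ≤ y ^ 4 * Real.exp (-y ^ 2 / 2) := by
          gcongr; exact gaussianPDFReal_zero_one_le y
      _ ≤ (8 * Real.exp (y ^ 2 / 2)) * Real.exp (-y ^ 2 / 2) := by
          gcongr
          norm_num [Nat.factorial] at hz
          nlinarith
      _ = 8 := by rw [mul_assoc, ← Real.exp_add]; ring_nf; simp
  have hx : (1 + (y + θ) ^ 2) ^ 2 ≤ 2 + 16 * y ^ 4 + 16 * θ ^ 4 := by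
    have e1 : (y + θ) ^ 2 ≤ 2 * (y ^ 2 + θ ^ 2) := by nlinarith [sq_nonneg (y - θ)]
    have e2 : ((y + θ) ^ 2) ^ 2 ≤ (2 * (y ^ 2 + θ ^ 2)) ^ 2 := by gcongr
    nlinarith [sq_nonneg (y ^ 2 - θ ^ 2), sq_nonneg (1 - (y + θ) ^ 2)]
  have hθ : 0 ≤ θ ^ 4 := by positivity
  calc _ ≤ gaussianPDFReal 0 1 y * (2 + 16 * y ^ 4 + 16 * θ ^ 4) := by gcongr
    _ ≤ _ := by nlinarith

/-! ### Mixture densities -/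

theorem measurable_gaussianPDFReal_sub :
    Measurable fun p : ℝ × ℝ => gaussianPDFReal 0 1 (p.1 - p.2) :=
  (measurable_gaussianPDFReal 0 1).comp (measurable_fst.sub measurable_snd)

theorem integrable_gaussianPDFReal_sub (P : ProbabilityMeasure ℝ) (x : ℝ) :
    Integrable (fun θ => gaussianPDFReal 0 1 (x - θ)) (P : Measure ℝ) := by
  refine Integrable.of_bound
    (measurable_gaussianPDFReal_sub.comp measurable_prodMk_left).aestronglyMeasurable 1
    (Filter.Eventually.of_forall fun θ => ?_)
  rw [Real.norm_eq_abs, abs_of_nonneg (gaussianPDFReal_nonneg 0 1 _)]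
  exact gaussianPDFReal_zero_one_le_one _

theorem measurable_mixDensity (P : ProbabilityMeasure ℝ) : Measurable (mixDensity P) :=
  (measurable_gaussianPDFReal_sub.stronglyMeasurable.integral_prod_right).measurable

theorem mixDensity_pos (P : ProbabilityMeasure ℝ) (x : ℝ) : 0 < mixDensity P x := by
  refine (integral_pos_iff_support_of_nonneg (fun θ => gaussianPDFReal_nonneg 0 1 _)
    (integrable_gaussianPDFReal_sub P x)).2 ?_
  have : Function.support (fun θ => gaussianPDFReal 0 1 (x - θ)) = Set.univ :=
    Set.eq_univ_of_forall fun θ => (gaussianPDFReal_pos 0 1 _ one_ne_zero).ne'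
  simp [this]

theorem mixDensity_nonneg (P : ProbabilityMeasure ℝ) (x : ℝ) : 0 ≤ mixDensity P x :=
  (mixDensity_pos P x).le

theorem lintegral_mixDensity (P : ProbabilityMeasure ℝ) :
    ∫⁻ x, ENNReal.ofReal (mixDensity P x) = 1 := by
  have h1 : ∀ x, ENNReal.ofReal (mixDensity P x) =
      ∫⁻ θ, ENNReal.ofReal (gaussianPDFReal 0 1 (x - θ)) ∂(P : Measure ℝ) := fun x =>
    ofReal_integral_eq_lintegral_ofReal (integrable_gaussianPDFReal_sub P x)
      (Filter.Eventually.of_forall fun θ => gaussianPDFReal_nonneg 0 1 _)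
  simp_rw [h1]
  rw [lintegral_lintegral_swap measurable_gaussianPDFReal_sub.ennreal_ofReal.aemeasurable]
  have h2 : ∀ θ : ℝ, ∫⁻ x, ENNReal.ofReal (gaussianPDFReal 0 1 (x - θ)) = 1 := by
    intro θ
    rw [lintegral_sub_right_eq_self (fun x => ENNReal.ofReal (gaussianPDFReal 0 1 x)) θ]
    exact lintegral_gaussianPDFReal_eq_one 0 one_ne_zero
  simp [h2]

theorem integrable_mixDensity (P : ProbabilityMeasure ℝ) : Integrable (mixDensity P) := by
  refine ⟨(measurable_mixDensity P).aestronglyMeasurable, ?_⟩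
  rw [hasFiniteIntegral_iff_ofReal (Filter.Eventually.of_forall (mixDensity_nonneg P)),
    lintegral_mixDensity]
  exact ENNReal.one_lt_top

theorem integral_mixDensity (P : ProbabilityMeasure ℝ) : ∫ x, mixDensity P x = 1 := by
  rw [integral_eq_lintegral_of_nonneg_ae (Filter.Eventually.of_forall (mixDensity_nonneg P))
    (measurable_mixDensity P).aestronglyMeasurable, lintegral_mixDensity]
  rfl

theorem integrable_pow_four {P : ProbabilityMeasure ℝ} {V : ℝ}
    (hP : ∫⁻ θ, ENNReal.ofReal (θ ^ 4) ∂(P : Measure ℝ) ≤ ENNReal.ofReal V) :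
    Integrable (fun θ : ℝ => θ ^ 4) (P : Measure ℝ) := by
  refine ⟨(measurable_id.pow_const 4).aestronglyMeasurable, ?_⟩
  rw [hasFiniteIntegral_iff_ofReal (Filter.Eventually.of_forall fun θ => by positivity)]
  exact hP.trans_lt ENNReal.ofReal_lt_top

theorem integral_pow_four_le {P : ProbabilityMeasure ℝ} {V : ℝ} (hV : 0 ≤ V)
    (hP : ∫⁻ θ, ENNReal.ofReal (θ ^ 4) ∂(P : Measure ℝ) ≤ ENNReal.ofReal V) :
    ∫ θ, θ ^ 4 ∂(P : Measure ℝ) ≤ V := by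
  rw [integral_eq_lintegral_of_nonneg_ae (Filter.Eventually.of_forall fun θ => by positivity)
    (by fun_prop)]
  exact ENNReal.toReal_le_of_le_ofReal hV hP

/-- A bound on the fourth moment of the mixing distribution makes the mixture density decay
like `x ^ (-4)`, so that its square root is integrable. -/
theorem mixDensity_decay {P : ProbabilityMeasure ℝ} {V : ℝ} (hV : 0 ≤ V)
    (hP : ∫⁻ θ, ENNReal.ofReal (θ ^ 4) ∂(P : Measure ℝ) ≤ ENNReal.ofReal V) (x : ℝ) :
    mixDensity P x ≤ 200 * (1 + V) / (1 + x ^ 2) ^ 2 := by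
  have hi := integrable_pow_four hP
  calc mixDensity P x ≤ ∫ θ, 200 * (1 + θ ^ 4) / (1 + x ^ 2) ^ 2 ∂(P : Measure ℝ) :=
        integral_mono (integrable_gaussianPDFReal_sub P x)
          ((((integrable_const 1).add hi).const_mul 200).div_const _)
          fun θ => gaussianPDFReal_decay x θ
    _ = 200 * (1 + ∫ θ, θ ^ 4 ∂(P : Measure ℝ)) / (1 + x ^ 2) ^ 2 := by
        rw [integral_div, integral_const_mul, integral_add (integrable_const 1) hi]
        simp
    _ ≤ _ := by
        gcongr
        exact integral_pow_four_le hV hP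

/-- A mixture with fourth moment of order `M ^ 4` is uniformly within order `M` of `φ`. -/
theorem abs_mixDensity_sub_gaussianPDFReal_le {P : ProbabilityMeasure ℝ} {V M : ℝ} (hV : 0 ≤ V)
    (hM : 0 < M)
    (hP : ∫⁻ θ, ENNReal.ofReal (θ ^ 4) ∂(P : Measure ℝ) ≤ ENNReal.ofReal (V * M ^ 4)) (x : ℝ) :
    |mixDensity P x - gaussianPDFReal 0 1 x| ≤ M * (1 + V) := by
  have hi := integrable_pow_four hP
  have h1 : mixDensity P x - gaussianPDFReal 0 1 x =
      ∫ θ, (gaussianPDFReal 0 1 (x - θ) - gaussianPDFReal 0 1 x) ∂(P : Measure ℝ) := by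
    rw [integral_sub (integrable_gaussianPDFReal_sub P x) (integrable_const _)]
    simp [mixDensity]
  have hb : ∀ θ : ℝ, |θ| ≤ M * (1 + θ ^ 4 / M ^ 4) := by
    intro θ
    have e : θ ^ 4 / M ^ 4 = (|θ| / M) ^ 4 := by
      rw [div_pow, ← abs_pow, abs_of_nonneg (by positivity : 0 ≤ θ ^ 4)]
    have h2 : |θ| / M ≤ 1 + (|θ| / M) ^ 4 := by
      nlinarith [sq_nonneg (|θ| / M - 1), sq_nonneg ((|θ| / M) ^ 2 - 1), sq_nonneg (|θ| / M)]
    rw [e]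
    calc |θ| = M * (|θ| / M) := by field_simp
      _ ≤ _ := by gcongr
  rw [h1, ← Real.norm_eq_abs]
  calc _ ≤ ∫ θ, M * (1 + θ ^ 4 / M ^ 4) ∂(P : Measure ℝ) := by
        refine norm_integral_le_of_norm_le
          (((integrable_const 1).add (hi.div_const _)).const_mul M)
          (Filter.Eventually.of_forall fun θ => ?_)
        exact (abs_gaussianPDFReal_sub_le x θ).trans (hb θ)
    _ = M * (1 + (∫ θ, θ ^ 4 ∂(P : Measure ℝ)) / M ^ 4) := by
        rw [integral_const_mul, integral_add (integrable_const 1) (hi.div_const _), integral_div]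
        simp
    _ ≤ M * (1 + V) := by
        gcongr
        rw [div_le_iff₀ (by positivity)]
        exact integral_pow_four_le (by positivity) hP

/-! ### Quantization of mixing distributions by local moments -/

/-- The local moment of order `l` of `P` on the set `I`, centred at `a` and scaled by `r`, with
respect to the Gaussian weight `exp (-(θ - a)² / 2)`. With this weight, the mixture density is a
power series in `x - a` whose coefficients are the local moments. -/
noncomputable def localMoment (P : ProbabilityMeasure ℝ) (I : Set ℝ) (a r : ℝ) (l : ℕ) : ℝ :=
  ∫ θ in I, ((θ - a) / r) ^ l * Real.exp (-(θ - a) ^ 2 / 2) ∂(P : Measure ℝ)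

theorem norm_localMoment_integrand_le {a r θ : ℝ} (hr : 0 < r) (h : |θ - a| ≤ r) (l : ℕ) :
    ‖((θ - a) / r) ^ l * Real.exp (-(θ - a) ^ 2 / 2)‖ ≤ 1 := by
  rw [Real.norm_eq_abs, abs_mul, abs_pow, Real.abs_exp, abs_div, abs_of_pos hr]
  refine mul_le_one₀ (pow_le_one₀ (by positivity) ((div_le_one hr).2 h)) (Real.exp_nonneg _) ?_
  exact Real.exp_le_one_iff.2 (by nlinarith [sq_nonneg (θ - a)])

theorem integrableOn_localMoment (P : ProbabilityMeasure ℝ) {I : Set ℝ} {a r : ℝ}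
    (hI : MeasurableSet I) (hr : 0 < r) (h : ∀ θ ∈ I, |θ - a| ≤ r) (l : ℕ) :
    IntegrableOn (fun θ => ((θ - a) / r) ^ l * Real.exp (-(θ - a) ^ 2 / 2)) I (P : Measure ℝ) := by
  refine Integrable.of_bound (by fun_prop) 1 ?_
  filter_upwards [ae_restrict_mem hI] with θ hθ
  exact norm_localMoment_integrand_le hr (h θ hθ) l

theorem abs_localMoment_le (P : ProbabilityMeasure ℝ) {I : Set ℝ} {a r : ℝ}
    (hr : 0 < r) (h : ∀ θ ∈ I, |θ - a| ≤ r) (l : ℕ) :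
    |localMoment P I a r l| ≤ 1 := by
  have := norm_setIntegral_le_of_norm_le_const (μ := (P : Measure ℝ)) (s := I) (C := 1)
    (measure_lt_top _ _) fun θ hθ => norm_localMoment_integrand_le hr (h θ hθ) l
  exact this.trans (by simp)

theorem abs_setIntegral_sub_sum_localMoment_le (P : ProbabilityMeasure ℝ) {I : Set ℝ} {a r q : ℝ}
    (hI : MeasurableSet I) (hr : 0 < r) (h : ∀ θ ∈ I, |θ - a| ≤ r) {L : ℕ}
    (hq0 : 0 ≤ q) (hq1 : q < 1)
    (hq : ∀ l, L ≤ l → r ^ l / √(l.factorial : ℝ) ≤ q ^ l) (x : ℝ) :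
    |(∫ θ in I, gaussianPDFReal 0 1 (x - θ) ∂(P : Measure ℝ)) - ∑ l ∈ Finset.range L,
      (gaussianPDFReal 0 1 (x - a) * (x - a) ^ l / l.factorial * r ^ l) * localMoment P I a r l| ≤
      q ^ L * (1 - q)⁻¹ * (P : Measure ℝ).real I := by
  have hi := integrableOn_localMoment P hI hr h
  simp only [localMoment]
  simp_rw [← integral_const_mul]
  rw [← integral_finsetSum _ fun l _ => (hi l).const_mul _,
    ← integral_sub (integrable_gaussianPDFReal_sub P x).integrableOn
      (integrable_finsetSum _ fun l _ => (hi l).const_mul _), ← Real.norm_eq_abs]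
  refine norm_setIntegral_le_of_norm_le_const (measure_lt_top _ _) fun θ hθ => ?_
  have h1 := abs_gaussianPDFReal_sub_sum_le (y := x - a) L (h θ hθ) hq0 hq1 hq
  rw [Real.norm_eq_abs]
  convert! h1 using 3
  · ring_nf
  · refine Finset.sum_congr rfl fun l _ => ?_
    rw [div_pow]
    field_simp

/-- Two mixing distributions whose local moments on `I` of order below `L` are `δ`-close have
close contributions from `I` to the mixture density. -/
theorem abs_setIntegral_sub_setIntegral_le (P Q : ProbabilityMeasure ℝ) {I : Set ℝ} {a r q δ : ℝ}
    (hI : MeasurableSet I) (hr : 0 < r) (h : ∀ θ ∈ I, |θ - a| ≤ r) {L : ℕ}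
    (hq0 : 0 ≤ q) (hq1 : q < 1)
    (hq : ∀ l, L ≤ l → r ^ l / √(l.factorial : ℝ) ≤ q ^ l) (hδ : 0 ≤ δ)
    (hPQ : ∀ l < L, |localMoment P I a r l - localMoment Q I a r l| ≤ δ) (x : ℝ) :
    |(∫ θ in I, gaussianPDFReal 0 1 (x - θ) ∂(P : Measure ℝ)) -
      ∫ θ in I, gaussianPDFReal 0 1 (x - θ) ∂(Q : Measure ℝ)| ≤
      Real.exp (r ^ 2 / 2) * δ +
        q ^ L * (1 - q)⁻¹ * ((P : Measure ℝ).real I + (Q : Measure ℝ).real I) := by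
  have hP := abs_setIntegral_sub_sum_localMoment_le P hI hr h hq0 hq1 hq x
  have hQ := abs_setIntegral_sub_sum_localMoment_le Q hI hr h hq0 hq1 hq x
  set c : ℕ → ℝ := fun l => gaussianPDFReal 0 1 (x - a) * (x - a) ^ l / l.factorial * r ^ l with hc
  have hmid : |∑ l ∈ Finset.range L, c l * localMoment P I a r l -
      ∑ l ∈ Finset.range L, c l * localMoment Q I a r l| ≤ Real.exp (r ^ 2 / 2) * δ := by
    rw [← Finset.sum_sub_distrib]
    calc _ ≤ ∑ l ∈ Finset.range L, |c l| * δ := by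
          refine (Finset.abs_sum_le_sum_abs _ _).trans (Finset.sum_le_sum fun l hl => ?_)
          rw [← mul_sub, abs_mul]
          gcongr
          exact hPQ l (Finset.mem_range.1 hl)
      _ ≤ _ := by
          rw [← Finset.sum_mul]
          gcongr
          exact gaussianPDFReal_mul_sum_le (x - a) hr.le L
  rw [abs_le] at hP hQ hmid ⊢
  constructor <;> linarith [hP.1, hP.2, hQ.1, hQ.2, hmid.1, hmid.2]

/-- The `k`-th cell of the partition of `[-M, M]` into intervals of length `2 * r`. -/
def cell (M r : ℝ) (k : ℕ) : Set ℝ :=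
  {θ | θ ∈ Set.Icc (-M) M ∧ ⌊(θ + M) / (2 * r)⌋₊ = k}

theorem measurableSet_cell (M r : ℝ) (k : ℕ) : MeasurableSet (cell M r k) := by
  refine measurableSet_Icc.inter ?_
  exact (Nat.measurable_floor.comp ((measurable_id.add_const M).div_const (2 * r)))
    (measurableSet_singleton k)

theorem abs_sub_le_of_mem_cell {M r θ : ℝ} {k : ℕ} (hr : 0 < r) (h : θ ∈ cell M r k) :
    |θ - (-M + (2 * k + 1) * r)| ≤ r := by
  obtain ⟨⟨h1, h2⟩, h3⟩ := h
  have h0 : 0 ≤ (θ + M) / (2 * r) := div_nonneg (by linarith) (by linarith)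
  rw [Nat.floor_eq_iff h0, le_div_iff₀ (by positivity), div_lt_iff₀ (by positivity)] at h3
  rw [abs_le]
  constructor <;> nlinarith [h3.1, h3.2]

theorem pairwiseDisjoint_cell (M r : ℝ) (s : Set ℕ) : s.PairwiseDisjoint (cell M r) := by
  intro i _ j _ hij
  rw [Function.onFun, Set.disjoint_left]
  rintro θ ⟨_, h1⟩ ⟨_, h2⟩
  exact hij (h1.symm.trans h2)

theorem biUnion_cell {M r : ℝ} {K : ℕ} (hr : 0 < r) (hK : M / r < K) :
    ⋃ k ∈ Finset.range K, cell M r k = Set.Icc (-M) M := by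
  ext θ
  simp only [Set.mem_iUnion, Finset.mem_range, cell, Set.mem_ofPred_eq]
  constructor
  · rintro ⟨k, _, h, _⟩
    exact h
  · intro h
    refine ⟨_, ?_, h, rfl⟩
    have hK0 : K ≠ 0 := by
      rintro rfl
      have := div_nonneg (by linarith [h.1, h.2] : 0 ≤ M) hr.le
      simp at hK
      linarith
    rw [Nat.floor_lt' hK0]
    refine lt_of_le_of_lt ?_ hK
    rw [div_le_div_iff₀ (by positivity) hr]
    nlinarith [h.2]

theorem mixDensity_eq_sum_cell (P : ProbabilityMeasure ℝ) {M r : ℝ} {K : ℕ} (hr : 0 < r)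
    (hK : M / r < K) (x : ℝ) :
    mixDensity P x =
      ∑ k ∈ Finset.range K, (∫ θ in cell M r k, gaussianPDFReal 0 1 (x - θ) ∂(P : Measure ℝ)) +
        ∫ θ in (Set.Icc (-M) M)ᶜ, gaussianPDFReal 0 1 (x - θ) ∂(P : Measure ℝ) := by
  have hi := integrable_gaussianPDFReal_sub P x
  rw [← integral_biUnion_finset _ (fun k _ => measurableSet_cell M r k)
    (pairwiseDisjoint_cell M r _) (fun k _ => hi.integrableOn), biUnion_cell hr hK,
    integral_add_compl measurableSet_Icc hi]
  rfl

theorem sum_measureReal_cell_le (P : ProbabilityMeasure ℝ) (M r : ℝ) (K : ℕ) :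
    ∑ k ∈ Finset.range K, (P : Measure ℝ).real (cell M r k) ≤ 1 := by
  rw [← measureReal_biUnion_finset (pairwiseDisjoint_cell M r _)
    fun k _ => measurableSet_cell M r k]
  exact measureReal_le_one

/-- There is a map from mixing distributions to a set of `(2 N + 1) ^ (K L)` codes such that
equality of codes forces the mixture densities to be uniformly close. The code of `P` lists the
roundings to precision `1 / N` of its first `L` local moments on each of the `K` cells. -/
theorem exists_quantization {M r q : ℝ} {K L N : ℕ} (hr : 0 < r) (hK : M / r < K) (hN : 0 < N)
    (hq0 : 0 ≤ q) (hq1 : q < 1)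
    (hq : ∀ l, L ≤ l → r ^ l / √(l.factorial : ℝ) ≤ q ^ l) :
    ∃ code : ProbabilityMeasure ℝ → (Fin K → Fin L → Fin (2 * N + 1)),
      ∀ P Q, code P = code Q → ∀ x, |mixDensity P x - mixDensity Q x| ≤
        K * (Real.exp (r ^ 2 / 2) / N) + 2 * (q ^ L * (1 - q)⁻¹) +
          (P : Measure ℝ).real (Set.Icc (-M) M)ᶜ + (Q : Measure ℝ).real (Set.Icc (-M) M)ᶜ := by
  have hN' : (0 : ℝ) < N := by exact_mod_cast hN
  let m : ProbabilityMeasure ℝ → ℕ → ℕ → ℝ := fun P k l =>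
    localMoment P (cell M r k) (-M + (2 * k + 1) * r) r l
  have hm : ∀ P k l, |m P k l| ≤ 1 := fun P k l =>
    abs_localMoment_le P hr (fun θ hθ => abs_sub_le_of_mem_cell hr hθ) l
  have hlt : ∀ P k l, ⌊(m P k l + 1) * N⌋₊ < 2 * N + 1 := by
    intro P k l
    have h1 := abs_le.1 (hm P k l)
    have h2 : (m P k l + 1) * N ≤ (2 * N : ℕ) := by
      push_cast
      nlinarith [h1.2]
    exact Nat.lt_succ_of_le (Nat.floor_le_of_le h2)
  refine ⟨fun P k l => ⟨⌊(m P k l + 1) * N⌋₊, hlt P k l⟩, fun P Q hPQ x => ?_⟩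
  have hclose : ∀ k < K, ∀ l < L, |m P k l - m Q k l| ≤ 1 / N := by
    intro k hk l hl
    have h := congrArg Fin.val (congrFun (congrFun hPQ ⟨k, hk⟩) ⟨l, hl⟩)
    simp only at h
    have hP0 : 0 ≤ (m P k l + 1) * N := mul_nonneg (by linarith [(abs_le.1 (hm P k l)).1]) hN'.le
    have hQ0 : 0 ≤ (m Q k l + 1) * N := mul_nonneg (by linarith [(abs_le.1 (hm Q k l)).1]) hN'.le
    have hP1 := Nat.floor_le hP0
    have hP2 := Nat.lt_floor_add_one ((m P k l + 1) * N)
    have hQ1 := Nat.floor_le hQ0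
    have hQ2 := Nat.lt_floor_add_one ((m Q k l + 1) * N)
    rw [h] at hP1 hP2
    rw [abs_le, ← neg_div, div_le_iff₀ hN', le_div_iff₀ hN']
    constructor <;> linarith
  have hcell : ∀ k ∈ Finset.range K,
      |(∫ θ in cell M r k, gaussianPDFReal 0 1 (x - θ) ∂(P : Measure ℝ)) -
        ∫ θ in cell M r k, gaussianPDFReal 0 1 (x - θ) ∂(Q : Measure ℝ)| ≤
      Real.exp (r ^ 2 / 2) / N + q ^ L * (1 - q)⁻¹ *
        ((P : Measure ℝ).real (cell M r k) + (Q : Measure ℝ).real (cell M r k)) := by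
    intro k hk
    have h := abs_setIntegral_sub_setIntegral_le P Q (measurableSet_cell M r k) hr
      (fun θ hθ => abs_sub_le_of_mem_cell hr hθ) hq0 hq1 hq (by positivity)
      (hclose k (Finset.mem_range.1 hk)) x
    rwa [mul_one_div] at h
  have hT : 0 ≤ q ^ L * (1 - q)⁻¹ := mul_nonneg (by positivity) (inv_nonneg.2 (by linarith))
  have hsum := (Finset.abs_sum_le_sum_abs _ _).trans (Finset.sum_le_sum hcell)
  rw [Finset.sum_sub_distrib, Finset.sum_add_distrib, ← Finset.mul_sum, Finset.sum_add_distrib,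
    Finset.sum_const, Finset.card_range, nsmul_eq_mul] at hsum
  have hmass := mul_le_mul_of_nonneg_left (add_le_add (sum_measureReal_cell_le P M r K)
    (sum_measureReal_cell_le Q M r K)) hT
  have hout : ∀ R : ProbabilityMeasure ℝ,
      |∫ θ in (Set.Icc (-M) M)ᶜ, gaussianPDFReal 0 1 (x - θ) ∂(R : Measure ℝ)| ≤
        (R : Measure ℝ).real (Set.Icc (-M) M)ᶜ := by
    intro R
    have h := norm_setIntegral_le_of_norm_le_const (μ := (R : Measure ℝ))
      (s := (Set.Icc (-M) M)ᶜ) (C := 1) (f := fun θ => gaussianPDFReal 0 1 (x - θ))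
      (measure_lt_top _ _) fun θ _ => by
        rw [Real.norm_eq_abs, abs_of_nonneg (gaussianPDFReal_nonneg 0 1 _)]
        exact gaussianPDFReal_zero_one_le_one _
    simpa using h
  have hP := abs_le.1 (hout P)
  have hQ := abs_le.1 (hout Q)
  have hS := abs_le.1 hsum
  rw [mixDensity_eq_sum_cell P hr hK, mixDensity_eq_sum_cell Q hr hK, abs_le]
  constructor <;> linarith [hP.1, hP.2, hQ.1, hQ.2, hS.1, hS.2]

/-! ### Hellinger distance and affinity of mixture densities -/

theorem integrable_sqrt_mixDensity_mul (P Q : ProbabilityMeasure ℝ) :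
    Integrable fun x => √(mixDensity P x * mixDensity Q x) := by
  refine ((integrable_mixDensity P).add (integrable_mixDensity Q)).mono'
    ((measurable_mixDensity P).mul (measurable_mixDensity Q)).sqrt.aestronglyMeasurable
    (Filter.Eventually.of_forall fun x => ?_)
  have hP := mixDensity_nonneg P x
  have hQ := mixDensity_nonneg Q x
  rw [Real.norm_eq_abs, abs_of_nonneg (Real.sqrt_nonneg _), Pi.add_apply]
  exact Real.sqrt_le_iff.2 ⟨by positivity, by nlinarith⟩

theorem sqrt_sub_sqrt_sq (P Q : ProbabilityMeasure ℝ) (x : ℝ) :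
    (√(mixDensity P x) - √(mixDensity Q x)) ^ 2 =
      mixDensity P x + mixDensity Q x - 2 * √(mixDensity P x * mixDensity Q x) := by
  rw [Real.sqrt_mul (mixDensity_nonneg P x), sub_sq, Real.sq_sqrt (mixDensity_nonneg P x),
    Real.sq_sqrt (mixDensity_nonneg Q x)]
  ring

theorem hellinger_sq (f g : ℝ → ℝ) : hellinger f g ^ 2 = ∫ x, (√(f x) - √(g x)) ^ 2 :=
  Real.sq_sqrt (integral_nonneg fun _ => sq_nonneg _)

theorem hellinger_mixDensity_sq (P Q : ProbabilityMeasure ℝ) :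
    hellinger (mixDensity P) (mixDensity Q) ^ 2 =
      2 - 2 * ∫ x, √(mixDensity P x * mixDensity Q x) := by
  rw [hellinger_sq]
  simp_rw [sqrt_sub_sqrt_sq]
  have hadd : Integrable fun x => mixDensity P x + mixDensity Q x :=
    (integrable_mixDensity P).add (integrable_mixDensity Q)
  rw [integral_sub hadd
    ((integrable_sqrt_mixDensity_mul P Q).const_mul 2),
    integral_add (integrable_mixDensity P) (integrable_mixDensity Q), integral_const_mul,
    integral_mixDensity, integral_mixDensity]
  norm_num

theorem hellinger_mixDensity_sq_le_two (P Q : ProbabilityMeasure ℝ) :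
    hellinger (mixDensity P) (mixDensity Q) ^ 2 ≤ 2 := by
  rw [hellinger_mixDensity_sq]
  have : 0 ≤ ∫ x, √(mixDensity P x * mixDensity Q x) :=
    integral_nonneg fun x => Real.sqrt_nonneg _
  linarith

theorem sqrt_mul_mixDensity_le {P : ProbabilityMeasure ℝ} {η W x : ℝ} (hη : 0 ≤ η)
    (hP : mixDensity P x ≤ W / (1 + x ^ 2) ^ 2) :
    √(η * mixDensity P x) ≤ √(η * W) * (1 + x ^ 2)⁻¹ := by
  have h : √(η * W) * (1 + x ^ 2)⁻¹ = √(η * (W / (1 + x ^ 2) ^ 2)) := by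
    rw [← mul_div_assoc, Real.sqrt_div' _ (by positivity), Real.sqrt_sq (by positivity)]
    rfl
  rw [h]
  gcongr

/-- Uniformly close mixture densities decaying like `x ^ (-4)` are close in Hellinger
distance, since `|√f - √g| ≤ √|f - g|` and `(√f - √g)² ≤ |√f - √g| (√f + √g)`. -/
theorem hellinger_mixDensity_sq_le {P Q : ProbabilityMeasure ℝ} {η W : ℝ} (hη : 0 ≤ η)
    (hPQ : ∀ x, |mixDensity P x - mixDensity Q x| ≤ η)
    (hP : ∀ x, mixDensity P x ≤ W / (1 + x ^ 2) ^ 2)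
    (hQ : ∀ x, mixDensity Q x ≤ W / (1 + x ^ 2) ^ 2) :
    hellinger (mixDensity P) (mixDensity Q) ^ 2 ≤ 2 * (√(η * W) * Real.pi) := by
  rw [hellinger_sq, ← integral_univ_inv_one_add_sq, ← integral_const_mul, ← integral_const_mul]
  refine integral_mono_of_nonneg (Filter.Eventually.of_forall fun _ => sq_nonneg _)
    ((integrable_inv_one_add_sq.const_mul _).const_mul _) (Filter.Eventually.of_forall fun x => ?_)
  have h1 := sqrt_mul_mixDensity_le hη (hP x)
  have h2 := sqrt_mul_mixDensity_le hη (hQ x)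
  rw [Real.sqrt_mul hη] at h1 h2
  have hp := Real.sqrt_nonneg (mixDensity P x)
  have hq := Real.sqrt_nonneg (mixDensity Q x)
  have hd := hPQ x
  rw [← Real.sq_sqrt (mixDensity_nonneg P x), ← Real.sq_sqrt (mixDensity_nonneg Q x),
    ← Real.sq_sqrt hη] at hd
  simp only
  generalize √(mixDensity P x) = p at *
  generalize √(mixDensity Q x) = q at *
  have he := Real.sqrt_nonneg η
  generalize √η = e at *
  have hpq : |p - q| ≤ e := by
    have h3 : |p - q| * |p - q| ≤ |p ^ 2 - q ^ 2| := by
      rw [sq_sub_sq, abs_mul, abs_of_nonneg (add_nonneg hp hq)]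
      refine mul_le_mul_of_nonneg_right ?_ (abs_nonneg _)
      rw [abs_le]
      constructor <;> linarith
    exact abs_le_of_sq_le_sq' (by nlinarith [abs_nonneg (p - q), sq_abs (p - q)]) he |> abs_le.2
  have h3 : (p - q) ^ 2 ≤ e * (p + q) := by
    rw [← sq_abs, sq]
    gcongr
    rw [abs_le]
    constructor <;> linarith
  linarith

/-- Enlarging one density by a constant `η` increases the Hellinger affinity by `O(√η)`, because
the square root of the other density is integrable. -/
theorem lintegral_sqrt_add_mul_le (P Q : ProbabilityMeasure ℝ) {η W : ℝ} (hη : 0 ≤ η)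
    (hP : ∀ x, mixDensity P x ≤ W / (1 + x ^ 2) ^ 2) :
    ∫⁻ x, ENNReal.ofReal √((mixDensity Q x + η) * mixDensity P x) ≤
      ENNReal.ofReal (1 - hellinger (mixDensity Q) (mixDensity P) ^ 2 / 2 +
        √(η * W) * Real.pi) := by
  have hi : Integrable fun x =>
      √(mixDensity Q x * mixDensity P x) + √(η * W) * (1 + x ^ 2)⁻¹ :=
    (integrable_sqrt_mixDensity_mul Q P).add (integrable_inv_one_add_sq.const_mul √(η * W))
  have hval : ∫ x, (√(mixDensity Q x * mixDensity P x) + √(η * W) * (1 + x ^ 2)⁻¹) =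
      1 - hellinger (mixDensity Q) (mixDensity P) ^ 2 / 2 + √(η * W) * Real.pi := by
    rw [integral_add (integrable_sqrt_mixDensity_mul Q P)
      (integrable_inv_one_add_sq.const_mul √(η * W)), integral_const_mul,
      integral_univ_inv_one_add_sq, hellinger_mixDensity_sq]
    ring
  rw [← hval, ofReal_integral_eq_lintegral_ofReal hi
    (Filter.Eventually.of_forall fun x => by positivity)]
  refine lintegral_mono fun x => ENNReal.ofReal_le_ofReal ?_
  have hp := mixDensity_nonneg P x
  have hq := mixDensity_nonneg Q x
  have h1 := sqrt_mul_mixDensity_le hη (hP x)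
  have h2 : √((mixDensity Q x + η) * mixDensity P x) ≤
      √(mixDensity Q x * mixDensity P x) + √(η * mixDensity P x) := by
    rw [add_mul]
    have ha : 0 ≤ mixDensity Q x * mixDensity P x := by positivity
    have hb : 0 ≤ η * mixDensity P x := by positivity
    refine Real.sqrt_le_iff.2 ⟨by positivity, ?_⟩
    nlinarith [Real.sq_sqrt ha, Real.sq_sqrt hb,
      mul_nonneg (Real.sqrt_nonneg (mixDensity Q x * mixDensity P x))
        (Real.sqrt_nonneg (η * mixDensity P x))]
  linarith

/-! ### The likelihood-ratio deviation bound -/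

theorem lintegral_prod_comp_eq {Ω : Type*} [MeasurableSpace Ω] {μ : Measure Ω}
    [IsProbabilityMeasure μ] {n : ℕ} {X : Fin n → Ω → ℝ} {ν : Measure ℝ} (hind : iIndepFun X μ)
    (hlaw : ∀ i, HasLaw (X i) ν μ) {g : ℝ → ℝ≥0∞} (hg : Measurable g) :
    ∫⁻ ω, ∏ i, g (X i ω) ∂μ = (∫⁻ x, g x ∂ν) ^ n := by
  have hm : ∀ i, AEMeasurable (X i) μ := fun i => (hlaw i).aemeasurable
  let Y : Fin n → Ω → ℝ := fun i => (hm i).mk (X i)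
  have hY : ∀ i, X i =ᵐ[μ] Y i := fun i => (hm i).ae_eq_mk
  have hYm : ∀ i, Measurable (Y i) := fun i => (hm i).measurable_mk
  have hYind : iIndepFun Y μ := hind.congr hY
  have h1 : ∫⁻ ω, ∏ i, g (X i ω) ∂μ = ∫⁻ ω, ∏ i, g (Y i ω) ∂μ := by
    refine lintegral_congr_ae ?_
    filter_upwards [ae_all_iff.2 hY] with ω hω
    simp [hω]
  rw [h1, lintegral_prod_eq_prod_lintegral_of_indepFun Finset.univ (fun i ω => g (Y i ω))
    (hYind.comp (fun _ => g) fun _ => hg) fun i => hg.comp (hYm i)]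
  have h2 : ∀ i, ∫⁻ ω, g (Y i ω) ∂μ = ∫⁻ x, g x ∂ν := by
    intro i
    rw [← (hlaw i).lintegral_comp hg.aemeasurable]
    refine lintegral_congr_ae ?_
    filter_upwards [hY i] with ω hω
    rw [hω]
  simp [h2]

/-- Chernoff bound with exponent `1 / 2`: the likelihood of the inflated density `f_Q + η` beats
that of the true density with probability at most the `n`-th power of their affinity. -/
theorem measure_prod_le_prod_le {Ω : Type*} [MeasurableSpace Ω] {μ : Measure Ω}
    [IsProbabilityMeasure μ] {n : ℕ} {X : Fin n → Ω → ℝ} {P : ProbabilityMeasure ℝ}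
    (hind : iIndepFun X μ) (hlaw : ∀ i, HasLaw (X i) (mixLaw P) μ) (Q : ProbabilityMeasure ℝ)
    {η W : ℝ} (hη : 0 ≤ η) (hP : ∀ x, mixDensity P x ≤ W / (1 + x ^ 2) ^ 2) :
    μ {ω | ∏ i, mixDensity P (X i ω) ≤ ∏ i, (mixDensity Q (X i ω) + η)} ≤
      ENNReal.ofReal (Real.exp (-(n * (hellinger (mixDensity Q) (mixDensity P) ^ 2 / 2 -
        √(η * W) * Real.pi)))) := by
  set g : ℝ → ℝ≥0∞ := fun x => ENNReal.ofReal √((mixDensity Q x + η) / mixDensity P x) with hg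
  have hgm : Measurable g :=
    (((measurable_mixDensity Q).add_const η).div (measurable_mixDensity P)).sqrt.ennreal_ofReal
  have hQη : ∀ x, 0 < mixDensity Q x + η := fun x => by linarith [mixDensity_pos Q x]
  have hsub : {ω | ∏ i, mixDensity P (X i ω) ≤ ∏ i, (mixDensity Q (X i ω) + η)} ⊆
      {ω | 1 ≤ ∏ i, g (X i ω)} := by
    intro ω hω
    have hpos : 0 < ∏ i, mixDensity P (X i ω) := Finset.prod_pos fun i _ => mixDensity_pos P _
    change 1 ≤ ∏ i, g (X i ω)
    rw [hg, ← ENNReal.ofReal_prod_of_nonneg fun i _ => Real.sqrt_nonneg _, ENNReal.one_le_ofReal,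
      ← Real.sqrt_prod _ fun i _ => (div_pos (hQη _) (mixDensity_pos P _)).le, Real.one_le_sqrt,
      Finset.prod_div_distrib, one_le_div hpos]
    exact hω
  have hgi : ∫⁻ x, g x ∂(mixLaw P) =
      ∫⁻ x, ENNReal.ofReal √((mixDensity Q x + η) * mixDensity P x) := by
    rw [mixLaw, lintegral_withDensity_eq_lintegral_mul _
      (measurable_mixDensity P).ennreal_ofReal hgm]
    refine lintegral_congr fun x => ?_
    have hp := mixDensity_pos P x
    rw [Pi.mul_apply, hg, ← ENNReal.ofReal_mul hp.le]
    congr 1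
    rw [Real.sqrt_div' _ hp.le, Real.sqrt_mul (hQη x).le]
    nth_rw 1 [← Real.mul_self_sqrt hp.le]
    have := Real.sqrt_pos.2 hp
    field_simp
  have hmark := mul_meas_ge_le_lintegral₀ (μ := μ) (f := fun ω => ∏ i, g (X i ω))
    (Finset.aemeasurable_fun_prod _ fun i _ => hgm.comp_aemeasurable (hlaw i).aemeasurable) 1
  rw [one_mul, lintegral_prod_comp_eq hind hlaw hgm, hgi] at hmark
  refine (measure_mono hsub).trans (hmark.trans ?_)
  rw [neg_mul_eq_mul_neg, Real.exp_nat_mul, ENNReal.ofReal_pow (Real.exp_nonneg _)]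
  gcongr
  refine (lintegral_sqrt_add_mul_le P Q hη hP).trans (ENNReal.ofReal_le_ofReal ?_)
  refine le_trans (le_of_eq ?_) (Real.add_one_le_exp _)
  ring

theorem IsNPMLE.prod_mixDensity_le {n : ℕ} {𝒬 : Set (ProbabilityMeasure ℝ)} {x : Fin n → ℝ}
    {P Phat : ProbabilityMeasure ℝ} (h : IsNPMLE 𝒬 x Phat) (hP : P ∈ 𝒬) :
    ∏ i, mixDensity P (x i) ≤ ∏ i, mixDensity Phat (x i) := by
  rcases Nat.eq_zero_or_pos n with rfl | hn
  · simp
  have h1 : logLikelihood x P ≤ logLikelihood x Phat := h.2 hP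
  have hn' : (0 : ℝ) < 1 / n := by positivity
  rw [logLikelihood, logLikelihood, mul_le_mul_iff_right₀ hn',
    ← Real.log_prod fun i _ => (mixDensity_pos _ _).ne',
    ← Real.log_prod fun i _ => (mixDensity_pos _ _).ne'] at h1
  exact (Real.log_le_log_iff (Finset.prod_pos fun i _ => mixDensity_pos _ _)
    (Finset.prod_pos fun i _ => mixDensity_pos _ _)).1 h1

/-- Deviation bound for the NPMLE over a class that is split into finitely many code cells of
uniform diameter `η`. -/
theorem measureReal_hellinger_npmle_le {Ω : Type*} [MeasurableSpace Ω] {μ : Measure Ω}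
    [IsProbabilityMeasure μ] {n : ℕ} {X : Fin n → Ω → ℝ} {P : ProbabilityMeasure ℝ}
    (hind : iIndepFun X μ) (hlaw : ∀ i, HasLaw (X i) (mixLaw P) μ)
    {𝒬 : Set (ProbabilityMeasure ℝ)} (hP𝒬 : P ∈ 𝒬) {Phat : Ω → ProbabilityMeasure ℝ}
    (hPhat : ∀ ω, IsNPMLE 𝒬 (fun i => X i ω) (Phat ω))
    {ι : Type*} [Fintype ι] (code : ProbabilityMeasure ℝ → ι)
    {η W τ : ℝ} (hη : 0 ≤ η) (hτ : 0 ≤ τ) (hP : ∀ x, mixDensity P x ≤ W / (1 + x ^ 2) ^ 2)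
    (hcode : ∀ Q ∈ 𝒬, ∀ Q' ∈ 𝒬, code Q = code Q' → ∀ x, |mixDensity Q x - mixDensity Q' x| ≤ η) :
    μ.real {ω | τ ≤ hellinger (mixDensity (Phat ω)) (mixDensity P)} ≤
      Fintype.card ι * Real.exp (-(n * (τ ^ 2 / 2 - √(η * W) * Real.pi))) := by
  set E : ι → Set Ω := fun j =>
    {ω | code (Phat ω) = j ∧ τ ≤ hellinger (mixDensity (Phat ω)) (mixDensity P)} with hE
  have hunion : {ω | τ ≤ hellinger (mixDensity (Phat ω)) (mixDensity P)} ⊆ ⋃ j, E j :=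
    fun ω hω => Set.mem_iUnion.2 ⟨code (Phat ω), rfl, hω⟩
  have hbound : ∀ j, μ (E j) ≤
      ENNReal.ofReal (Real.exp (-(n * (τ ^ 2 / 2 - √(η * W) * Real.pi)))) := by
    intro j
    rcases (E j).eq_empty_or_nonempty with h0 | ⟨ω₀, hω₀, hτ₀⟩
    · simp [h0]
    -- Any member of the cell far from the truth bounds all the others from above, up to `η`.
    refine (measure_mono fun ω hω => ?_).trans
      ((measure_prod_le_prod_le hind hlaw (Phat ω₀) hη hP).trans (ENNReal.ofReal_le_ofReal ?_))
    · refine ((hPhat ω).prod_mixDensity_le hP𝒬).trans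
        (Finset.prod_le_prod (fun i _ => mixDensity_nonneg _ _) fun i _ => ?_)
      have := abs_le.1 (hcode _ (hPhat ω).1 _ (hPhat ω₀).1 (hω.1.trans hω₀.symm) (X i ω))
      linarith [this.2]
    · gcongr
  have hfin : μ {ω | τ ≤ hellinger (mixDensity (Phat ω)) (mixDensity P)} ≤
      ENNReal.ofReal (Fintype.card ι * Real.exp (-(n * (τ ^ 2 / 2 - √(η * W) * Real.pi)))) := by
    refine (measure_mono hunion).trans ((measure_iUnion_fintype_le μ E).trans
      ((Finset.sum_le_sum fun j _ => hbound j).trans (le_of_eq ?_)))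
    rw [Finset.sum_const, Finset.card_univ, nsmul_eq_mul, ENNReal.ofReal_mul (Nat.cast_nonneg _),
      ENNReal.ofReal_natCast]
  exact ENNReal.toReal_le_of_le_ofReal (by positivity) hfin

/-! ### The choice of the parameters of the quantization -/

theorem half_le_log_natCast {n : ℕ} (hn : 2 ≤ n) : 1 / 2 ≤ Real.log n := by
  have h1 : Real.log 2 ≤ Real.log n := Real.log_le_log (by norm_num) (by exact_mod_cast hn)
  linarith [Real.log_two_gt_d9]

theorem sqrt_le_two_mul {l : ℝ} (hl : 1 / 4 ≤ l) : √l ≤ 2 * l :=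
  Real.sqrt_le_iff.2 ⟨by linarith, by nlinarith⟩

/-- The square of the rate is `log n` times the number `log n / log (1 + √(log n) / M)` of moments
per cell, divided by `n`. -/
theorem natCast_mul_rateBounded_sq {n : ℕ} {M : ℝ} (hn : 2 ≤ n) (hM : 0 < M) :
    n * rateBounded n M ^ 2 =
      Real.log n * (Real.log n / Real.log (1 + √(Real.log n) / M)) := by
  have hl := half_le_log_natCast hn
  have hy : 0 < √(Real.log n) / M := div_pos (Real.sqrt_pos.2 (by linarith)) hM
  have hlog : 0 < Real.log (1 + √(Real.log n) / M) := Real.log_pos (by linarith)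
  have hn' : (0 : ℝ) < n := by positivity
  rw [rateBounded, div_pow, Real.sq_sqrt (by positivity)]
  field_simp

theorem rateBounded_nonneg {n : ℕ} {M : ℝ} : 0 ≤ rateBounded n M :=
  div_nonneg (Real.log_natCast_nonneg n) (Real.sqrt_nonneg _)

theorem pow_div_sqrt_factorial_le {r x : ℝ} {l : ℕ} (hx : 0 < x)
    (hl : Real.exp 1 * (r ^ 2 * (1 + x)) ≤ l) :
    r ^ l / √(l.factorial : ℝ) ≤ (√(1 + x))⁻¹ ^ l := by
  have hx' : 0 < √(1 + x) := Real.sqrt_pos.2 (by linarith)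
  have hf : 0 < √(l.factorial : ℝ) := Real.sqrt_pos.2 (by positivity)
  rw [inv_pow, div_le_iff₀ hf, ← div_eq_inv_mul, le_div_iff₀ (by positivity), ← mul_pow]
  apply Real.le_sqrt_of_sq_le
  rw [← pow_mul, mul_comm l 2, pow_mul, mul_pow, Real.sq_sqrt (by linarith)]
  have h1 := Real.pow_div_factorial_le_exp (x := (l : ℝ)) (Nat.cast_nonneg l) l
  rw [div_le_iff₀ (by positivity)] at h1
  have h2 : (Real.exp 1 * (r ^ 2 * (1 + x))) ^ l ≤ (l : ℝ) ^ l := by gcongr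
  rw [mul_pow, ← Real.exp_nat_mul, mul_one] at h2
  exact le_of_mul_le_mul_left (h2.trans h1) (Real.exp_pos _)

/-- With `14 log n / log (1 + x)` moments per cell, where the half-length of a cell is
`√(log n) / x`, the terms of the truncated series are dominated by a geometric series of ratio
`(1 + x) ^ (-1/2)`, and the truncation error is of order `n ^ (-7)`. -/
theorem quantization_order {n : ℕ} {r x : ℝ} {L : ℕ} (hn : 2 ≤ n) (hr : 0 < r) (hx : 1 ≤ x)
    (hrx : r * x = √(Real.log n)) (hL : 14 * Real.log n / Real.log (1 + x) ≤ L) :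
    (∀ l, L ≤ l → r ^ l / √(l.factorial : ℝ) ≤ (√(1 + x))⁻¹ ^ l) ∧
      (√(1 + x))⁻¹ < 1 ∧
      (√(1 + x))⁻¹ ^ L * (1 - (√(1 + x))⁻¹)⁻¹ ≤ 4 * ((n : ℝ) ^ 7)⁻¹ := by
  have hl := half_le_log_natCast hn
  have hn' : (0 : ℝ) < n := by positivity
  have hlog : 0 < Real.log (1 + x) := Real.log_pos (by linarith)
  have hlogx : Real.log (1 + x) ≤ x := by
    have := Real.log_le_sub_one_of_pos (by linarith : 0 < 1 + x)
    linarith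
  have hr2 : r ^ 2 * x ^ 2 = Real.log n := by
    rw [← mul_pow, hrx, Real.sq_sqrt (by linarith)]
  have hq34 : (√(1 + x))⁻¹ ≤ 3 / 4 := by
    have : 4 / 3 ≤ √(1 + x) := Real.le_sqrt_of_sq_le (by linarith)
    calc _ ≤ (4 / 3 : ℝ)⁻¹ := by gcongr
      _ = _ := by norm_num
  refine ⟨fun l hLl => pow_div_sqrt_factorial_le (by linarith) ?_, by linarith, ?_⟩
  · have h1 : (L : ℝ) ≤ l := by exact_mod_cast hLl
    refine le_trans ?_ (hL.trans h1)
    rw [le_div_iff₀ hlog, ← hr2]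
    have he := Real.exp_one_lt_d9
    calc Real.exp 1 * (r ^ 2 * (1 + x)) * Real.log (1 + x) ≤ 3 * (r ^ 2 * (2 * x)) * x := by
          gcongr <;> linarith
      _ ≤ 14 * (r ^ 2 * x ^ 2) := by nlinarith [mul_pos (pow_pos hr 2) (pow_pos (by linarith : 0 < x) 2)]
  · have hpow : (√(1 + x))⁻¹ ^ L ≤ ((n : ℝ) ^ 7)⁻¹ := by
      have hs : 0 < √(1 + x) := Real.sqrt_pos.2 (by linarith)
      rw [inv_pow]
      refine inv_anti₀ (by positivity) ?_
      rw [← Real.log_le_log_iff (by positivity) (by positivity), Real.log_pow, Real.log_pow,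
        Real.log_sqrt (by linarith)]
      rw [div_le_iff₀ hlog] at hL
      push_cast
      linarith
    have h4 : (1 - (√(1 + x))⁻¹)⁻¹ ≤ 4 := by
      calc _ ≤ (1 / 4 : ℝ)⁻¹ := inv_anti₀ (by norm_num) (by linarith)
        _ = 4 := by norm_num
    rw [mul_comm]
    gcongr

theorem one_sixth_le_log_div_log {n : ℕ} {M : ℝ} (hn : 2 ≤ n) (hM1 : 1 ≤ M * n ^ 4) (hM0 : 0 < M) :
    1 / 6 ≤ Real.log n / Real.log (1 + √(Real.log n) / M) := by
  have hn2 : (2 : ℝ) ≤ n := by exact_mod_cast hn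
  have hn0 : (0 : ℝ) < n := by linarith
  have hl := half_le_log_natCast hn
  set ℓ := Real.log n with hℓ
  have hℓn : ℓ ≤ n := (Real.log_le_self hn0.le)
  have hy0 : 0 < √ℓ / M := div_pos (Real.sqrt_pos.2 (by linarith)) hM0
  have hlogy : 0 < Real.log (1 + √ℓ / M) := Real.log_pos (by linarith)
  have hlog6 : Real.log (1 + √ℓ / M) ≤ 6 * ℓ := by
    have h1 : 1 + √ℓ / M ≤ (n : ℝ) ^ 6 := by
      have h2 : √ℓ / M ≤ (n : ℝ) ^ 5 := by
        rw [div_le_iff₀ hM0]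
        have h3 : √ℓ ≤ n := Real.sqrt_le_iff.2 ⟨hn0.le, by nlinarith⟩
        calc √ℓ ≤ n * 1 := by linarith
          _ ≤ n * (M * n ^ 4) := by gcongr
          _ = _ := by ring
      have h3 : (1 : ℝ) ≤ (n : ℝ) ^ 5 := one_le_pow₀ (by linarith)
      nlinarith
    calc _ ≤ Real.log ((n : ℝ) ^ 6) := Real.log_le_log (by linarith) h1
      _ = 6 * ℓ := by rw [Real.log_pow]; norm_num [hℓ]
  rw [le_div_iff₀ hlogy]
  linarith

/-- Entropy bound at the scale `n ^ (-6)`: the number of codes is exponential in the squared rate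
times `n`. -/
theorem exists_code {n : ℕ} {M : ℝ} (hn : 2 ≤ n) (hM1 : 1 ≤ M * n ^ 4) (hM2 : M ≤ n) :
    ∃ (ι : Type) (_ : Fintype ι) (code : ProbabilityMeasure ℝ → ι),
      (Fintype.card ι : ℝ) ≤ Real.exp (600 * (n * rateBounded n M ^ 2)) ∧
      ∀ P Q : ProbabilityMeasure ℝ, (P : Measure ℝ).real (Set.Icc (-M) M)ᶜ ≤ 2 * ((n : ℝ) ^ 6)⁻¹ →
        (Q : Measure ℝ).real (Set.Icc (-M) M)ᶜ ≤ 2 * ((n : ℝ) ^ 6)⁻¹ →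
        code P = code Q → ∀ x, |mixDensity P x - mixDensity Q x| ≤ 15 * ((n : ℝ) ^ 6)⁻¹ := by
  have hn2 : (2 : ℝ) ≤ n := by exact_mod_cast hn
  have hn0 : (0 : ℝ) < n := by linarith
  have hM : 0 < M := by
    by_contra h
    have : M * n ^ 4 ≤ 0 := mul_nonpos_of_nonpos_of_nonneg (not_lt.1 h) (by positivity)
    linarith
  rw [natCast_mul_rateBounded_sq hn hM]
  have hl := half_le_log_natCast hn
  set ℓ := Real.log n with hℓ
  have hℓn : ℓ ≤ n := (Real.log_le_self hn0.le)
  have hs0 : 0 < √ℓ := Real.sqrt_pos.2 (by linarith)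
  have hs1 : 1 / 2 ≤ √ℓ := Real.le_sqrt_of_sq_le (by linarith)
  set r := min M √ℓ with hr
  have hr0 : 0 < r := lt_min hM hs0
  set x := √ℓ / r with hx
  have hx1 : 1 ≤ x := (one_le_div hr0).2 (min_le_right _ _)
  have hrx : r * x = √ℓ := by rw [hx]; field_simp
  set L := ⌈14 * ℓ / Real.log (1 + x)⌉₊ with hL
  set K := ⌊M / r⌋₊ + 1 with hK
  have hKlt : M / r < K := by rw [hK]; push_cast; exact Nat.lt_floor_add_one _
  have hKle : (K : ℝ) ≤ M / r + 1 := by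
    rw [hK]; push_cast
    gcongr
    exact Nat.floor_le (by positivity)
  obtain ⟨hq, hq1, hqL⟩ := quantization_order hn hr0 hx1 hrx (Nat.le_ceil _ : _ ≤ (L : ℝ))
  obtain ⟨code, hcode⟩ := exists_quantization (N := n ^ 8) hr0 hKlt (by positivity)
    (by positivity) hq1 hq
  refine ⟨_, inferInstance, code, ?_, fun P Q hP hQ hPQ x => (hcode P Q hPQ x).trans ?_⟩
  · -- The product `K * L` is of order `log n / log (1 + √(log n) / M)`.
    have hKL : (K : ℝ) * L ≤ 60 * (ℓ / Real.log (1 + √ℓ / M)) := by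
      have hlog : 0 < Real.log (1 + x) := Real.log_pos (by linarith)
      have hLle : (L : ℝ) ≤ 14 * ℓ / Real.log (1 + x) + 1 :=
        (Nat.ceil_lt_add_one (by positivity)).le
      have hy0 : 0 < √ℓ / M := by positivity
      have hlogy : 0 < Real.log (1 + √ℓ / M) := Real.log_pos (by linarith)
      rcases le_total M √ℓ with h | h
      · have hrM : r = M := min_eq_left h
        have hK2 : (K : ℝ) ≤ 2 := by
          rw [hrM, div_self hM.ne'] at hKle
          linarith
        rw [hx, hrM] at hLle
        have hD : 1 / 6 ≤ ℓ / Real.log (1 + √ℓ / M) := one_sixth_le_log_div_log hn hM1 hM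
        calc (K : ℝ) * L ≤ 2 * (14 * ℓ / Real.log (1 + √ℓ / M) + 1) := by gcongr
          _ ≤ _ := by rw [mul_div_assoc]; linarith
      · have hrs : r = √ℓ := min_eq_right h
        have hx' : x = 1 := by rw [hx, hrs, div_self hs0.ne']
        have hlog2 : 1 / 2 ≤ Real.log (1 + x) := by
          rw [hx']; norm_num; linarith [Real.log_two_gt_d9]
        have hL30 : (L : ℝ) ≤ 30 * ℓ := by
          refine hLle.trans ?_
          have : 14 * ℓ / Real.log (1 + x) ≤ 14 * ℓ / (1 / 2) := by gcongr
          linarith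
        have hK2 : (K : ℝ) ≤ 2 * (M / √ℓ) := by
          rw [hrs] at hKle
          have : 1 ≤ M / √ℓ := (one_le_div hs0).2 h
          linarith
        have hlogy1 : Real.log (1 + √ℓ / M) ≤ √ℓ / M := by
          have := Real.log_le_sub_one_of_pos (by linarith : 0 < 1 + √ℓ / M)
          linarith
        have hD : ℓ / (√ℓ / M) ≤ ℓ / Real.log (1 + √ℓ / M) := by gcongr
        calc (K : ℝ) * L ≤ 2 * (M / √ℓ) * (30 * ℓ) := by gcongr
          _ = 60 * (ℓ / (√ℓ / M)) := by field_simp; norm_num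
          _ ≤ _ := by gcongr
    have hcard : 2 * (n : ℝ) ^ 8 + 1 ≤ Real.exp (10 * ℓ) := by
      have : Real.exp (10 * ℓ) = (n : ℝ) ^ 10 := by
        rw [show (10 : ℝ) * ℓ = (10 : ℕ) * ℓ by norm_num, Real.exp_nat_mul, hℓ, Real.exp_log hn0]
      rw [this]
      have h8 : (1 : ℝ) ≤ (n : ℝ) ^ 8 := one_le_pow₀ (by linarith)
      have h2 : (4 : ℝ) ≤ (n : ℝ) ^ 2 := by nlinarith
      calc _ ≤ (n : ℝ) ^ 8 * 4 := by linarith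
        _ ≤ (n : ℝ) ^ 8 * (n : ℝ) ^ 2 := by gcongr
        _ = _ := by ring
    simp only [Fintype.card_pi, Fintype.card_fin, Finset.prod_const, Finset.card_univ]
    push_cast
    calc ((2 * (n : ℝ) ^ 8 + 1) ^ L) ^ K ≤ ((Real.exp (10 * ℓ)) ^ L) ^ K := by gcongr
      _ = Real.exp (10 * ℓ * (K * L)) := by
          rw [← Real.exp_nat_mul, ← Real.exp_nat_mul]
          ring_nf
      _ ≤ Real.exp (10 * ℓ * (60 * (ℓ / Real.log (1 + √ℓ / M)))) := by gcongr
      _ = _ := by ring_nf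
  · have hK3 : (K : ℝ) ≤ 3 * n := by
      have h1 : M / r ≤ 2 * n := by
        rw [div_le_iff₀ hr0]
        rcases le_total M √ℓ with h | h
        · rw [hr, min_eq_left h]; nlinarith
        · rw [hr, min_eq_right h]; nlinarith
      linarith
    have hexp : Real.exp (r ^ 2 / 2) ≤ n := by
      have h1 : r ^ 2 ≤ √ℓ ^ 2 := by
        gcongr
        exact min_le_right _ _
      rw [Real.sq_sqrt (by linarith)] at h1
      calc _ ≤ Real.exp ℓ := by gcongr; linarith
        _ = n := Real.exp_log hn0
    have h1 : (K : ℝ) * (Real.exp (r ^ 2 / 2) / (n ^ 8 : ℕ)) ≤ 3 * ((n : ℝ) ^ 6)⁻¹ := by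
      push_cast
      calc _ ≤ (3 * n : ℝ) * (n / n ^ 8) := by gcongr
        _ = _ := by field_simp
    have h2 : ((n : ℝ) ^ 7)⁻¹ ≤ ((n : ℝ) ^ 6)⁻¹ := by
      gcongr
      · linarith
      · norm_num
    linarith

/-! ### The rate of the NPMLE over a class with light tails -/

/-- Very large classes: the rate is bounded below, so a multiple of it exceeds the largest possible
Hellinger distance `√2`. -/
theorem quarter_le_rateBounded_sq {n : ℕ} {M : ℝ} (hn : 2 ≤ n) (hM : (n : ℝ) ≤ M) :
    1 / 4 ≤ rateBounded n M ^ 2 := by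
  have hn2 : (2 : ℝ) ≤ n := by exact_mod_cast hn
  have hM0 : 0 < M := by linarith
  have h := natCast_mul_rateBounded_sq hn hM0
  have hl := half_le_log_natCast hn
  set ℓ := Real.log n with hℓ
  have hs0 : 0 < √ℓ := Real.sqrt_pos.2 (by linarith)
  have hs := sqrt_le_two_mul (by linarith : 1 / 4 ≤ ℓ)
  have hy0 : 0 < √ℓ / M := by positivity
  have hlogy : 0 < Real.log (1 + √ℓ / M) := Real.log_pos (by linarith)
  have hlogy1 : Real.log (1 + √ℓ / M) ≤ 2 * ℓ / n := by
    have := Real.log_le_sub_one_of_pos (by linarith : 0 < 1 + √ℓ / M)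
    calc _ ≤ √ℓ / M := by linarith
      _ ≤ 2 * ℓ / n := by gcongr
  have hD : (n : ℝ) / 2 ≤ ℓ / Real.log (1 + √ℓ / M) := by
    rw [le_div_iff₀ hlogy]
    calc _ ≤ (n : ℝ) / 2 * (2 * ℓ / n) := by gcongr
      _ = ℓ := by field_simp
  have : (n : ℝ) * (1 / 4) ≤ n * rateBounded n M ^ 2 := by
    rw [h]
    calc (n : ℝ) * (1 / 4) = 1 / 2 * (n / 2) := by ring
      _ ≤ _ := by gcongr
  exact le_of_mul_le_mul_left this (by linarith)

/-- Very small classes: the Hellinger diameter, at most of order `M ^ (1/4)`, is bounded by a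
multiple of the rate. -/
theorem sqrt_le_rateBounded_sq {n : ℕ} {M : ℝ} (hn : 2 ≤ n) (hM0 : 0 < M)
    (hM : M * n ^ 4 ≤ 1) : √M ≤ 48 * rateBounded n M ^ 2 := by
  have hn2 : (2 : ℝ) ≤ n := by exact_mod_cast hn
  have h := natCast_mul_rateBounded_sq hn hM0
  have hl := half_le_log_natCast hn
  set ℓ := Real.log n with hℓ
  have hs0 : 0 < √ℓ := Real.sqrt_pos.2 (by linarith)
  have hs := sqrt_le_two_mul (by linarith : 1 / 4 ≤ ℓ)
  have hy0 : 0 < √ℓ / M := by positivity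
  have hlogy : 0 < Real.log (1 + √ℓ / M) := Real.log_pos (by linarith)
  set w := √√M with hw
  set v := √√(1 + √ℓ / M) with hv
  have hw0 : 0 ≤ w := Real.sqrt_nonneg _
  have hv0 : 0 < v := Real.sqrt_pos.2 (Real.sqrt_pos.2 (by linarith))
  have hw2 : w ^ 2 = √M := Real.sq_sqrt (Real.sqrt_nonneg _)
  have hw4 : w ^ 4 = M := by
    rw [show w ^ 4 = (w ^ 2) ^ 2 by ring, hw2, Real.sq_sqrt hM0.le]
  have hv4 : v ^ 4 = 1 + √ℓ / M := by
    rw [show v ^ 4 = (v ^ 2) ^ 2 by ring, hv, Real.sq_sqrt (Real.sqrt_nonneg _),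
      Real.sq_sqrt (by linarith)]
  have hlogv : Real.log (1 + √ℓ / M) ≤ 4 * v := by
    rw [← hv4, Real.log_pow]
    have := Real.log_le_self hv0.le
    push_cast
    linarith
  have hnw : n * w ≤ 1 := by
    refine le_of_pow_le_pow_left₀ (n := 4) (by norm_num) (by norm_num) ?_
    rw [mul_pow, hw4, one_pow, mul_comm]
    exact hM
  have hM1 : M ≤ 1 := by
    have : (1 : ℝ) ≤ (n : ℝ) ^ 4 := one_le_pow₀ (by linarith)
    nlinarith
  have hwv4 : (w * v) ^ 4 = M + √ℓ := by
    rw [mul_pow, hw4, hv4]; field_simp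
  have hwv : w * v ≤ 6 * ℓ := by
    have : w * v ≤ 1 + (w * v) ^ 4 := by
      nlinarith [sq_nonneg (w * v - 1), sq_nonneg ((w * v) ^ 2 - 1)]
    linarith
  have hmain : √M * n * Real.log (1 + √ℓ / M) ≤ 48 * ℓ ^ 2 := by
    rw [← hw2]
    calc w ^ 2 * n * Real.log (1 + √ℓ / M) ≤ w ^ 2 * n * (4 * v) := by gcongr
      _ = 4 * (n * w) * (w * v) := by ring
      _ ≤ 4 * 1 * (6 * ℓ) := by gcongr
      _ ≤ _ := by nlinarith
  have hle : (n : ℝ) * √M ≤ n * (48 * rateBounded n M ^ 2) := by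
    rw [mul_left_comm, h, ← mul_div_assoc, ← mul_div_assoc, le_div_iff₀ hlogy]
    linarith
  exact le_of_mul_le_mul_left hle (by linarith)

theorem log_le_rateBounded_sq {n : ℕ} {M : ℝ} (hn : 2 ≤ n) (hM1 : 1 ≤ M * n ^ 4) (hM0 : 0 < M) :
    Real.log n ≤ 6 * (n * rateBounded n M ^ 2) := by
  rw [natCast_mul_rateBounded_sq hn hM0]
  have hD := one_sixth_le_log_div_log hn hM1 hM0
  have hl := half_le_log_natCast hn
  calc Real.log n = 6 * (Real.log n * (1 / 6)) := by ring
    _ ≤ _ := by gcongr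

/-- Deviation bound for the NPMLE over any class of mixing distributions that have mass at most
`2 n ^ (-6)` outside `[-M, M]` and fourth moments of order `M ^ 4`. -/
theorem measureReal_npmle_le {V : ℝ} (hV : 0 ≤ V) {n : ℕ} {M s : ℝ} (hn : 2 ≤ n) (hM : 0 < M)
    (hs : 8000 * (1 + V) ≤ s) {𝒬 : Set (ProbabilityMeasure ℝ)}
    (hmass : ∀ Q ∈ 𝒬, (Q : Measure ℝ).real (Set.Icc (-M) M)ᶜ ≤ 2 * ((n : ℝ) ^ 6)⁻¹)
    (hmom : ∀ Q ∈ 𝒬, ∫⁻ θ, ENNReal.ofReal (θ ^ 4) ∂(Q : Measure ℝ) ≤ ENNReal.ofReal (V * M ^ 4))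
    {P : ProbabilityMeasure ℝ} (hP : P ∈ 𝒬) {Ω : Type*} [MeasurableSpace Ω] {μ : Measure Ω}
    [IsProbabilityMeasure μ] {X : Fin n → Ω → ℝ} {Phat : Ω → ProbabilityMeasure ℝ}
    (hind : iIndepFun X μ) (hlaw : ∀ i, HasLaw (X i) (mixLaw P) μ)
    (hPhat : ∀ ω, IsNPMLE 𝒬 (fun i => X i ω) (Phat ω)) :
    μ.real {ω | s * rateBounded n M ≤ hellinger (mixDensity (Phat ω)) (mixDensity P)} ≤
      (n : ℝ) ^ (-(1 / 24 * s ^ 2)) := by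
  have hn2 : (2 : ℝ) ≤ n := by exact_mod_cast hn
  have hn0 : (0 : ℝ) < n := by linarith
  have hl := half_le_log_natCast hn
  have hR0 : 0 ≤ rateBounded n M := rateBounded_nonneg
  have hRpos : 0 < n * rateBounded n M ^ 2 := by
    rw [natCast_mul_rateBounded_sq hn hM]
    have hy0 : 0 < √(Real.log n) / M := div_pos (Real.sqrt_pos.2 (by linarith)) hM
    have := Real.log_pos (by linarith : 1 < 1 + √(Real.log n) / M)
    positivity
  have hR2 : 0 < rateBounded n M ^ 2 := (mul_pos_iff_of_pos_left hn0).1 hRpos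
  have hs0 : 0 < s := by linarith
  have hs2 : 64000000 * (1 + V) ≤ s ^ 2 := by nlinarith
  -- In the extreme regimes the event is empty.
  have hempty : (∀ Q ∈ 𝒬, hellinger (mixDensity Q) (mixDensity P) ^ 2 <
      s ^ 2 * rateBounded n M ^ 2) →
      μ.real {ω | s * rateBounded n M ≤ hellinger (mixDensity (Phat ω)) (mixDensity P)} ≤
      (n : ℝ) ^ (-(1 / 24 * s ^ 2)) := by
    intro h
    have : {ω | s * rateBounded n M ≤ hellinger (mixDensity (Phat ω)) (mixDensity P)} = ∅ := by
      refine Set.eq_empty_of_forall_notMem fun ω hω => ?_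
      have h1 : (s * rateBounded n M) ^ 2 ≤ hellinger (mixDensity (Phat ω)) (mixDensity P) ^ 2 :=
        pow_le_pow_left₀ (by positivity) hω 2
      rw [mul_pow] at h1
      exact absurd (h _ (hPhat ω).1) (not_lt.2 h1)
    rw [this]
    simp only [measureReal_empty]
    positivity
  rcases le_or_gt (n : ℝ) M with hMn | hMn
  · refine hempty fun Q _ => ?_
    have h1 := hellinger_mixDensity_sq_le_two Q P
    have h2 := quarter_le_rateBounded_sq hn hMn
    nlinarith
  have hdecay : ∀ Q ∈ 𝒬, ∀ x, mixDensity Q x ≤ 200 * (1 + V * M ^ 4) / (1 + x ^ 2) ^ 2 :=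
    fun Q hQ x => mixDensity_decay (by positivity) (hmom Q hQ) x
  rcases lt_or_ge (M * n ^ 4) 1 with hM4 | hM4
  · refine hempty fun Q hQ => ?_
    have hM1 : M ≤ 1 := by
      have : (1 : ℝ) ≤ (n : ℝ) ^ 4 := one_le_pow₀ (by linarith)
      nlinarith
    have hclose : ∀ x, |mixDensity Q x - mixDensity P x| ≤ 2 * M * (1 + V) := by
      intro x
      have h1 := abs_le.1 (abs_mixDensity_sub_gaussianPDFReal_le hV hM (hmom Q hQ) x)
      have h2 := abs_le.1 (abs_mixDensity_sub_gaussianPDFReal_le hV hM (hmom P hP) x)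
      rw [abs_le]
      constructor <;> linarith [h1.1, h1.2, h2.1, h2.2]
    have h1 := hellinger_mixDensity_sq_le (by positivity) hclose (hdecay Q hQ) (hdecay P hP)
    have h2 : √(2 * M * (1 + V) * (200 * (1 + V * M ^ 4))) ≤ 20 * (1 + V) * √M := by
      refine Real.sqrt_le_iff.2 ⟨by positivity, ?_⟩
      rw [mul_pow, Real.sq_sqrt hM.le]
      have hM4' : M ^ 4 ≤ 1 := pow_le_one₀ hM.le hM1
      have : V * M ^ 4 ≤ V * 1 := by gcongr
      calc _ ≤ 2 * M * (1 + V) * (200 * (1 + V * 1)) := by gcongr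
        _ = _ := by ring
    have h3 := sqrt_le_rateBounded_sq hn hM hM4.le
    calc _ ≤ 2 * (20 * (1 + V) * √M * 4) := by
          refine h1.trans ?_
          gcongr
          exact Real.pi_le_four
      _ = 160 * (1 + V) * √M := by ring
      _ ≤ 160 * (1 + V) * (48 * rateBounded n M ^ 2) := by gcongr
      _ = 7680 * (1 + V) * rateBounded n M ^ 2 := by ring
      _ < s ^ 2 * rateBounded n M ^ 2 := by
          refine mul_lt_mul_of_pos_right ?_ hR2
          nlinarith
  · obtain ⟨ι, _, code, hcard, hcode⟩ := exists_code hn hM4 hMn.le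
    have h1 := measureReal_hellinger_npmle_le hind hlaw hP hPhat code
      (η := 15 * ((n : ℝ) ^ 6)⁻¹) (by positivity) (mul_nonneg hs0.le hR0) (hdecay P hP)
      fun Q hQ Q' hQ' => hcode Q Q' (hmass Q hQ) (hmass Q' hQ')
    have h2 : √(15 * ((n : ℝ) ^ 6)⁻¹ * (200 * (1 + V * M ^ 4))) ≤ 60 * (1 + V) / n := by
      refine Real.sqrt_le_iff.2 ⟨by positivity, ?_⟩
      have h4 : 1 + V * M ^ 4 ≤ (1 + V) * n ^ 4 := by
        have h5 : (1 : ℝ) ≤ (n : ℝ) ^ 4 := one_le_pow₀ (by linarith)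
        have h6 : V * M ^ 4 ≤ V * n ^ 4 := by gcongr
        linarith
      calc _ ≤ 15 * ((n : ℝ) ^ 6)⁻¹ * (200 * ((1 + V) * n ^ 4)) := by gcongr
        _ = 3000 * (1 + V) / n ^ 2 := by field_simp; norm_num
        _ ≤ 3600 * (1 + V) ^ 2 / n ^ 2 := by gcongr ?_ / _; nlinarith
        _ = _ := by ring
    have h3 : n * (√(15 * ((n : ℝ) ^ 6)⁻¹ * (200 * (1 + V * M ^ 4))) * Real.pi) ≤
        240 * (1 + V) := by
      calc _ ≤ n * (60 * (1 + V) / n * 4) := by gcongr; exact Real.pi_le_four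
        _ = _ := by field_simp; norm_num
    have h6 := log_le_rateBounded_sq hn hM4 hM
    refine h1.trans ?_
    rw [Real.rpow_def_of_pos hn0]
    calc _ ≤ Real.exp (600 * (n * rateBounded n M ^ 2)) * _ := by gcongr
      _ ≤ _ := by
        rw [← Real.exp_add, Real.exp_le_exp, mul_sub, mul_pow]
        have h7 : 240 * (1 + V) ≤ 480 * (1 + V) * Real.log n := by nlinarith
        have h8 : 480 * (1 + V) * Real.log n ≤
            480 * (1 + V) * (6 * (n * rateBounded n M ^ 2)) := by gcongr
        have h9 : 64000000 * (1 + V) * (n * rateBounded n M ^ 2) ≤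
            s ^ 2 * (n * rateBounded n M ^ 2) := by gcongr
        have h10 : s ^ 2 * Real.log n ≤ s ^ 2 * (6 * (n * rateBounded n M ^ 2)) := by gcongr
        nlinarith [mul_nonneg hV hRpos.le]

/-! ### Bounded and sub-Weibull classes -/

theorem measure_compl_Icc_of_mem_boundedFamily {M : ℝ} {P : ProbabilityMeasure ℝ}
    (hP : P ∈ boundedFamily M) : (P : Measure ℝ) (Set.Icc (-M) M)ᶜ = 0 :=
  (prob_compl_eq_zero_iff measurableSet_Icc).2 hP

theorem lintegral_pow_four_le_of_mem_boundedFamily {M : ℝ} {P : ProbabilityMeasure ℝ}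
    (hP : P ∈ boundedFamily M) :
    ∫⁻ θ, ENNReal.ofReal (θ ^ 4) ∂(P : Measure ℝ) ≤ ENNReal.ofReal (M ^ 4) := by
  have hae : ∀ᵐ θ ∂(P : Measure ℝ), θ ∈ Set.Icc (-M) M :=
    measure_compl_Icc_of_mem_boundedFamily hP
  calc _ ≤ ∫⁻ _, ENNReal.ofReal (M ^ 4) ∂(P : Measure ℝ) := by
        refine lintegral_mono_ae ?_
        filter_upwards [hae] with θ hθ
        refine ENNReal.ofReal_le_ofReal ?_
        have h : |θ| ≤ M := abs_le.2 hθ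
        rw [← Even.pow_abs (by decide : Even 4) θ]
        gcongr
    _ = _ := by simp

/-- The scale `2 * β` avoids the question whether the infimum in the Orlicz norm is attained. -/
theorem lintegral_exp_le_of_mem_subWeibullFamily {α β : ℝ} (hα : 0 < α) (hβ : 0 < β)
    {P : ProbabilityMeasure ℝ} (hP : P ∈ subWeibullFamily α β) :
    ∫⁻ θ, ENNReal.ofReal (Real.exp ((|θ| / (2 * β)) ^ α)) ∂(P : Measure ℝ) ≤ 2 := by
  have hlt : orliczNorm (fun x => Real.exp (x ^ α) - 1) P < ENNReal.ofReal (2 * β) :=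
    lt_of_le_of_lt hP ((ENNReal.ofReal_lt_ofReal_iff (by linarith)).2 (by linarith))
  obtain ⟨_, ⟨t, ht0, ht, rfl⟩, htβ⟩ := sInf_lt_iff.1 hlt
  have htβ' : t < 2 * β := (ENNReal.ofReal_lt_ofReal_iff (by linarith)).1 htβ
  calc _ ≤ ∫⁻ θ, (ENNReal.ofReal (Real.exp ((|θ| / t) ^ α) - 1) + 1) ∂(P : Measure ℝ) := by
        refine lintegral_mono fun θ => ?_
        have h0 : 0 ≤ (|θ| / t) ^ α := by positivity
        rw [← ENNReal.ofReal_one, ← ENNReal.ofReal_add (by simpa using h0) zero_le_one,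
          sub_add_cancel]
        refine ENNReal.ofReal_le_ofReal (Real.exp_le_exp.2 ?_)
        gcongr
    _ ≤ 1 + 1 := by
        rw [lintegral_add_right _ measurable_const]
        gcongr
        simp
    _ = 2 := one_add_one_eq_two

/-- The effective support radius of the sub-Weibull class: up to a constant, the quantile of
order `1 - n ^ (-6)` of its extreme members. -/
noncomputable def subWeibullRadius (n : ℕ) (α β : ℝ) : ℝ :=
  2 * β * (6 * Real.log n) ^ (1 / α)

theorem two_mul_le_subWeibullRadius {n : ℕ} {α β : ℝ} (hn : 2 ≤ n) (hα : 0 < α) (hβ : 0 < β) :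
    2 * β ≤ subWeibullRadius n α β := by
  have hl := half_le_log_natCast hn
  have : 1 ≤ (6 * Real.log n) ^ (1 / α) := Real.one_le_rpow (by linarith) (by positivity)
  rw [subWeibullRadius]
  nlinarith

theorem measureReal_compl_Icc_le_of_mem_subWeibullFamily {n : ℕ} {α β : ℝ} (hn : 2 ≤ n)
    (hα : 0 < α) (hβ : 0 < β) {P : ProbabilityMeasure ℝ} (hP : P ∈ subWeibullFamily α β) :
    (P : Measure ℝ).real (Set.Icc (-subWeibullRadius n α β) (subWeibullRadius n α β))ᶜ ≤
      2 * ((n : ℝ) ^ 6)⁻¹ := by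
  have hn0 : (0 : ℝ) < n := by positivity
  have hl := half_le_log_natCast hn
  have hsub : (Set.Icc (-subWeibullRadius n α β) (subWeibullRadius n α β))ᶜ ⊆
      {θ | ENNReal.ofReal ((n : ℝ) ^ 6) ≤
        ENNReal.ofReal (Real.exp ((|θ| / (2 * β)) ^ α))} := by
    intro θ hθ
    have h1 : subWeibullRadius n α β ≤ |θ| := by
      by_contra h
      exact hθ (abs_le.1 (not_le.1 h).le)
    refine ENNReal.ofReal_le_ofReal ?_
    have h2 : (6 * Real.log n) ^ (1 / α) ≤ |θ| / (2 * β) := by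
      rw [le_div_iff₀ (by positivity), mul_comm]
      exact h1
    have h3 : 6 * Real.log n ≤ (|θ| / (2 * β)) ^ α := by
      calc 6 * Real.log n = ((6 * Real.log n) ^ (1 / α)) ^ α := by
            rw [← Real.rpow_mul (by linarith), one_div_mul_cancel hα.ne', Real.rpow_one]
        _ ≤ _ := by gcongr
    calc (n : ℝ) ^ 6 = Real.exp (6 * Real.log n) := by
          rw [show (6 : ℝ) * Real.log n = (6 : ℕ) * Real.log n by norm_num, Real.exp_nat_mul,
            Real.exp_log hn0]
      _ ≤ _ := Real.exp_le_exp.2 h3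
  have hm : Measurable fun θ : ℝ => ENNReal.ofReal (Real.exp ((|θ| / (2 * β)) ^ α)) := by
    fun_prop
  have h := (mul_meas_ge_le_lintegral hm (ENNReal.ofReal ((n : ℝ) ^ 6))).trans
    (lintegral_exp_le_of_mem_subWeibullFamily hα hβ hP)
  have h4 := (mul_le_mul_right (measure_mono hsub) (ENNReal.ofReal ((n : ℝ) ^ 6))).trans h
  have h5 := ENNReal.toReal_mono (by simp) h4
  rw [ENNReal.toReal_mul, ENNReal.toReal_ofReal (by positivity)] at h5
  rw [← div_eq_mul_inv, le_div_iff₀ (by positivity), mul_comm]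
  exact h5

theorem lintegral_pow_four_le_of_mem_subWeibullFamily {α β : ℝ} (hα : 0 < α) (hβ : 0 < β)
    {P : ProbabilityMeasure ℝ} (hP : P ∈ subWeibullFamily α β) :
    ∫⁻ θ, ENNReal.ofReal (θ ^ 4) ∂(P : Measure ℝ) ≤
      ENNReal.ofReal (2 * (⌈4 / α⌉₊.factorial : ℝ) * (2 * β) ^ 4) := by
  set k := ⌈4 / α⌉₊ with hk
  have hpt : ∀ θ : ℝ, θ ^ 4 ≤ (k.factorial : ℝ) * (2 * β) ^ 4 *
      Real.exp ((|θ| / (2 * β)) ^ α) := by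
    intro θ
    set z := |θ| / (2 * β) with hz
    have hz0 : 0 ≤ z := by positivity
    have hθ : θ ^ 4 = (2 * β) ^ 4 * z ^ 4 := by
      rw [← mul_pow, hz, mul_div_cancel₀ _ (by positivity), Even.pow_abs (by decide)]
    have hf : (1 : ℝ) ≤ k.factorial := by exact_mod_cast k.factorial_pos
    have hmain : z ^ 4 ≤ k.factorial * Real.exp (z ^ α) := by
      rcases le_total z 1 with h1 | h1
      · have h2 : z ^ 4 ≤ 1 := pow_le_one₀ hz0 h1
        have h3 : 1 ≤ Real.exp (z ^ α) := Real.one_le_exp (by positivity)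
        nlinarith
      · have h2 := Real.pow_div_factorial_le_exp (x := z ^ α) (by positivity) k
        rw [div_le_iff₀ (by positivity)] at h2
        have h3 : 4 ≤ α * k := by
          have := Nat.le_ceil (4 / α)
          rw [div_le_iff₀ hα] at this
          linarith
        calc z ^ 4 = z ^ (4 : ℝ) := by norm_cast
          _ ≤ z ^ (α * k) := Real.rpow_le_rpow_of_exponent_le h1 h3
          _ = (z ^ α) ^ k := by rw [Real.rpow_mul hz0, Real.rpow_natCast]
          _ ≤ _ := by linarith
    rw [hθ]
    calc _ ≤ (2 * β) ^ 4 * (k.factorial * Real.exp (z ^ α)) := by gcongr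
      _ = _ := by ring
  calc _ ≤ ∫⁻ θ, ENNReal.ofReal ((k.factorial : ℝ) * (2 * β) ^ 4) *
        ENNReal.ofReal (Real.exp ((|θ| / (2 * β)) ^ α)) ∂(P : Measure ℝ) := by
        refine lintegral_mono fun θ => ?_
        rw [← ENNReal.ofReal_mul (by positivity)]
        exact ENNReal.ofReal_le_ofReal (hpt θ)
    _ ≤ ENNReal.ofReal ((k.factorial : ℝ) * (2 * β) ^ 4) * 2 := by
        rw [lintegral_const_mul' _ _ ENNReal.ofReal_ne_top]
        gcongr
        exact lintegral_exp_le_of_mem_subWeibullFamily hα hβ hP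
    _ = _ := by
        rw [← ENNReal.ofReal_ofNat 2, ← ENNReal.ofReal_mul (by positivity)]
        ring_nf

theorem log_one_add_div_le {y D : ℝ} (hy : 0 ≤ y) (hD : 1 ≤ D) :
    Real.log (1 + y) / D ≤ Real.log (1 + y / D) := by
  have hD0 : 0 < D := by linarith
  have hyD : 0 ≤ y / D := by positivity
  have h := one_add_mul_self_le_rpow_one_add (s := y / D) (by linarith) hD
  rw [mul_div_cancel₀ _ hD0.ne'] at h
  rw [div_le_iff₀ hD0, mul_comm, ← Real.log_rpow (by linarith)]
  exact Real.log_le_log (by linarith) h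

/-- The sub-Weibull rate is, up to a constant, the rate of the bounded class whose radius is the
effective support radius. -/
theorem rateBounded_subWeibullRadius_le {n : ℕ} {α β : ℝ} (hn : 2 ≤ n) (hα : 0 < α)
    (hβ : 0 < β) :
    rateBounded n (subWeibullRadius n α β) ≤
      √(2 * 6 ^ (1 / α)) * rateSubWeibull n α β := by
  have hl := half_le_log_natCast hn
  have hl0 : 0 < Real.log n := by linarith
  have hn0 : (0 : ℝ) < n := by positivity
  set D : ℝ := 2 * 6 ^ (1 / α) with hD
  have hD1 : 1 ≤ D := by
    have : (1 : ℝ) ≤ 6 ^ (1 / α) := Real.one_le_rpow (by norm_num) (by positivity)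
    linarith
  set y : ℝ := (Real.log n) ^ ((α - 2) / (2 * α)) / β with hy
  have hy0 : 0 < y := by positivity
  have harg : √(Real.log n) / subWeibullRadius n α β = y / D := by
    have h1 : (α - 2) / (2 * α) = 1 / 2 - 1 / α := by field_simp
    rw [hy, h1, Real.rpow_sub hl0, ← Real.sqrt_eq_rpow, subWeibullRadius,
      Real.mul_rpow (by norm_num) hl0.le, hD]
    have : 0 < Real.log n ^ (1 / α) := by positivity
    field_simp
  rw [rateBounded, rateSubWeibull, harg, ← hy]
  have hlog : 0 < Real.log (1 + y) := Real.log_pos (by linarith)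
  have hle := log_one_add_div_le hy0.le hD1
  have hD0 : 0 < D := by linarith
  calc _ ≤ Real.log n / √(n * (Real.log (1 + y) / D)) := by gcongr
    _ = _ := by
      rw [← mul_div_assoc, Real.sqrt_div' _ hD0.le]
      field_simp

end GaussianMixture

theorem theorem8 :
    (∀ c : ℝ, 0 < c → ∃ sstar c' : ℝ, 0 < sstar ∧ 0 < c' ∧
      ∀ (n : ℕ) (M : ℝ), 2 ≤ n → 0 < M → M ≤ (n : ℝ) ^ c →
      ∀ Pstar ∈ GaussianMixture.boundedFamily M,
      ∀ (Ω : Type*) (_ : MeasurableSpace Ω) (μ : Measure Ω) (_ : IsProbabilityMeasure μ)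
        (X : Fin n → Ω → ℝ) (Phat : Ω → ProbabilityMeasure ℝ),
      iIndepFun X μ → (∀ i, HasLaw (X i) (GaussianMixture.mixLaw Pstar) μ) →
      (∀ ω, GaussianMixture.IsNPMLE (GaussianMixture.boundedFamily M)
        (fun i => X i ω) (Phat ω)) →
      ∀ s : ℝ, sstar ≤ s →
        μ.real {ω | s * GaussianMixture.rateBounded n M ≤
          GaussianMixture.hellinger (GaussianMixture.mixDensity (Phat ω))
            (GaussianMixture.mixDensity Pstar)} ≤ (n : ℝ) ^ (-(c' * s ^ 2))) ∧
    (∀ α c : ℝ, 0 < α → 0 < c → ∃ sstar c' : ℝ, 0 < sstar ∧ 0 < c' ∧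
      ∀ (n : ℕ) (β : ℝ), 2 ≤ n → 0 < β → β ≤ (n : ℝ) ^ c →
      ∀ Pstar ∈ GaussianMixture.subWeibullFamily α β,
      ∀ (Ω : Type*) (_ : MeasurableSpace Ω) (μ : Measure Ω) (_ : IsProbabilityMeasure μ)
        (X : Fin n → Ω → ℝ) (Phat : Ω → ProbabilityMeasure ℝ),
      iIndepFun X μ → (∀ i, HasLaw (X i) (GaussianMixture.mixLaw Pstar) μ) →
      (∀ ω, GaussianMixture.IsNPMLE (GaussianMixture.subWeibullFamily α β)
        (fun i => X i ω) (Phat ω)) →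
      ∀ s : ℝ, sstar ≤ s →
        μ.real {ω | s * GaussianMixture.rateSubWeibull n α β ≤
          GaussianMixture.hellinger (GaussianMixture.mixDensity (Phat ω))
            (GaussianMixture.mixDensity Pstar)} ≤ (n : ℝ) ^ (-(c' * s ^ 2))) := by
  constructor
  · intro c _
    refine ⟨8000 * (1 + 1), 1 / 24, by norm_num, by norm_num, ?_⟩
    intro n M hn hM _ P hP Ω _ μ _ X Phat hind hlaw hPhat s hs
    refine GaussianMixture.measureReal_npmle_le zero_le_one hn hM hs (fun Q hQ => ?_)
      (fun Q hQ => ?_) hP hind hlaw hPhat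
    · rw [Measure.real, GaussianMixture.measure_compl_Icc_of_mem_boundedFamily hQ,
        ENNReal.toReal_zero]
      positivity
    · rw [one_mul]
      exact GaussianMixture.lintegral_pow_four_le_of_mem_boundedFamily hQ
  · intro α c hα _
    set V : ℝ := 2 * (⌈4 / α⌉₊.factorial : ℝ) with hV
    set D : ℝ := 2 * 6 ^ (1 / α) with hD
    have hD0 : 0 < D := by positivity
    refine ⟨8000 * (1 + V) * √D, 1 / (24 * D), by positivity, by positivity, ?_⟩
    intro n β hn hβ _ P hP Ω _ μ _ X Phat hind hlaw hPhat s hs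
    have hβM := GaussianMixture.two_mul_le_subWeibullRadius hn hα hβ
    have hs' : 8000 * (1 + V) ≤ s / √D := (le_div_iff₀ (Real.sqrt_pos.2 hD0)).2 hs
    have hs0 : 0 ≤ s := le_trans (by positivity) hs
    have h := GaussianMixture.measureReal_npmle_le (V := V)
      (M := GaussianMixture.subWeibullRadius n α β) (by positivity) hn (by linarith) hs'
      (fun Q hQ => GaussianMixture.measureReal_compl_Icc_le_of_mem_subWeibullFamily hn hα hβ hQ)
      (fun Q hQ => (GaussianMixture.lintegral_pow_four_le_of_mem_subWeibullFamily hα hβ hQ).trans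
        (ENNReal.ofReal_le_ofReal (by gcongr))) hP hind hlaw hPhat
    have hexp : 1 / (24 * D) * s ^ 2 = 1 / 24 * (s / √D) ^ 2 := by
      rw [div_pow, Real.sq_sqrt hD0.le]
      field_simp
    rw [hexp]
    refine (measureReal_mono fun ω hω => ?_).trans h
    simp only [Set.mem_ofPred_eq] at hω ⊢
    refine le_trans ?_ hω
    have hr := GaussianMixture.rateBounded_subWeibullRadius_le hn hα hβ
    calc _ ≤ s / √D * (√D * GaussianMixture.rateSubWeibull n α β) := by gcongr
      _ = _ := by
        have := Real.sqrt_pos.2 hD0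
        field_simp
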